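/- Let $\mathbb D$ be the open unit disk in $\mathbb C$ and let $dA$ be area measure on $\mathbb D$ divided by $\pi$. For real $\beta$ put $dA_\beta(z)=c_\beta(1-|z|^2)^\beta\,dA(z)$, where $c_\beta=\beta+1$ if $\beta>-1$ and $c_\beta=1$ otherwise. Let $A^2_\beta$ be the space of analytic functions $f$ on $\mathbb D$ with $$\int_{\mathbb D}(1-|z|^2)^{2k}|f^{(k)}(z)|^2\,dA_\beta(z)<\infty,$$ where $k$ is the least non-negative integer with $2k+\beta>-1$ (any other integer $k\ge0$ with $2k+\beta>-1$ defines the same space). For $\alpha>-1$ (so that $k=0$), $A^2_\alpha$ is a Hilbert space with the inner product of $L^2(\mathbb D,dA_\alpha)$. Theorem. Let $\alpha>-1$, and let $\varphi$ be an analytic function on $\mathbb D$ with $|\varphi(z)|\le1$ for all $z\in\mathbb D$ which is not a constant of modulus $1$. Let $T_\varphi:A^2_\alpha\to A^2_\alpha$, $T_\varphi f=\varphi f$, let $T_\varphi^*$ be its adjoint on $A^2_\alpha$, and let $E_{\overline\varphi}=I-T_\varphi^*T_\varphi$. Then the following conditions are equivalent: (a) the operator $E_{\overline\varphi}$ is compact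 on $A^2_\alpha$; (b) $\varphi$ is a finite Blaschke product, that is, $\varphi(z)=c\prod_{i=1}^n\frac{z-a_i}{1-\overline{a_i}z}$ on $\mathbb D$ for some $n\ge0$, some $c\in\mathbb C$ with $|c|=1$ and some $a_1,\dots,a_n\in\mathbb D$; (c) the range $E_{\overline\varphi}(A^2_\alpha)$ equals $A^2_{\alpha-2}$; (d) the range $E_{\overline\varphi}(A^2_\alpha)$ is contained in $A^2_{\alpha-2}$. -/

import Mathlib

open MeasureTheory Metric Set Filter Topology
open scoped ENNReal ComplexConjugate

noncomputable section

namespace WeightedBergman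

/-! ### Weighted area measures and the generalized Bergman spaces as sets of functions

Functions on the open unit disk `ball (0 : ℂ) 1` are represented by functions `ℂ → ℂ`; the values
outside the disk are irrelevant to every definition below. -/

/-- The density with respect to Lebesgue measure of `dA_α = (1 - |z|²)^α dA`, where `dA` is area
measure divided by `π`. For `α > -1` the factor `α + 1` makes `A_α` a probability measure; for
`α ≤ -1` the measure is infinite and there is no normalization. -/
def areaDensity (α : ℝ) (z : ℂ) : ℝ :=
  open Classical in (if -1 < α then α + 1 else 1) / Real.pi * (1 - ‖z‖ ^ 2) ^ α

/-- The weighted area measure `A_α` on the unit disk. -/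
def weightedArea (α : ℝ) : Measure ℂ :=
  (volume.restrict (ball (0 : ℂ) 1)).withDensity fun z => ENNReal.ofReal (areaDensity α z)

/-- The least `k : ℕ` with `2 k + β > -1`. -/
def derivOrder (β : ℝ) : ℕ := sInf {k : ℕ | -1 < 2 * (k : ℝ) + β}

/-- The generalized Bergman space `A²_β`, for any real `β`: the analytic functions `F` on the unit
disk with `∫ (1 - |z|²)^{2k} |F^{(k)}(z)|² dA_β(z) < ∞`, where `k` is a non-negative integer with
`2 k + β > -1`. -/
def genBergman (β : ℝ) : Set (ℂ → ℂ) :=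
  {F | DifferentiableOn ℂ F (ball 0 1) ∧
    Integrable (fun z => (1 - ‖z‖ ^ 2) ^ (2 * derivOrder β) * ‖iteratedDeriv (derivOrder β) F z‖ ^ 2)
      (weightedArea β)}

/-- The closed unit ball of `H^∞`. -/
def unitBallHInfty : Set (ℂ → ℂ) :=
  {φ | DifferentiableOn ℂ φ (ball 0 1) ∧ ∀ z ∈ ball (0 : ℂ) 1, ‖φ z‖ ≤ 1}

/-- Finite Blaschke products, as functions on the unit disk. The empty product (a unimodular
constant) is included. -/
def IsFiniteBlaschkeProduct (φ : ℂ → ℂ) : Prop :=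
  ∃ (n : ℕ) (a : Fin n → ℂ) (c : ℂ), ‖c‖ = 1 ∧ (∀ i, ‖a i‖ < 1) ∧
    ∀ z ∈ ball (0 : ℂ) 1, φ z = c * ∏ i, (z - a i) / (1 - conj (a i) * z)

/-! ### The Hilbert space `A²_α` -/

theorem weightedArea_absolutelyContinuous (α : ℝ) :
    weightedArea α ≪ volume.restrict (ball (0 : ℂ) 1) :=
  withDensity_absolutelyContinuous _ _

theorem ae_mem_ball (α : ℝ) : ∀ᵐ z ∂weightedArea α, z ∈ ball (0 : ℂ) 1 :=
  (weightedArea_absolutelyContinuous α).ae_le (ae_restrict_mem measurableSet_ball)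

theorem aestronglyMeasurable_of_differentiableOn (α : ℝ) {F : ℂ → ℂ}
    (hF : DifferentiableOn ℂ F (ball 0 1)) : AEStronglyMeasurable F (weightedArea α) :=
  (hF.continuousOn.aestronglyMeasurable measurableSet_ball).mono_ac
    (weightedArea_absolutelyContinuous α)

/-- The Hilbert space `A²_α` (`α > -1`): the subspace of `L²(A_α)` of the classes that contain an
analytic function on the disk, with the inner product of `L²(A_α)`. -/
def bergman (α : ℝ) : Submodule ℂ (Lp ℂ 2 (weightedArea α)) where
  carrier := {f | ∃ F : ℂ → ℂ, DifferentiableOn ℂ F (ball 0 1) ∧ f =ᵐ[weightedArea α] F}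
  zero_mem' := ⟨0, differentiableOn_const 0, Lp.coeFn_zero _ _ _⟩
  add_mem' := by
    rintro f g ⟨F, hF, hfF⟩ ⟨G, hG, hgG⟩
    exact ⟨F + G, hF.add hG, (Lp.coeFn_add f g).trans (hfF.add hgG)⟩
  smul_mem' := by
    rintro c f ⟨F, hF, hfF⟩
    refine ⟨c • F, hF.const_smul c, (Lp.coeFn_smul c f).trans ?_⟩
    filter_upwards [hfF] with z hz
    simp [hz]

theorem areaMean {F : ℂ → ℂ} {z : ℂ} {ρ : ℝ} (hρ : 0 < ρ)
    (hF : DifferentiableOn ℂ F (ball z ρ)) :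
    ‖F z‖ₑ * ENNReal.ofReal (ρ / 2) ^ 2 ≤ ∫⁻ w in ball z ρ, ‖F w‖ₑ := by
  classical
  set H : ℂ → ℝ≥0∞ := (ball z ρ).indicator fun w => ‖F w‖ₑ with hH
  have hmeas : Measurable H := by
    have : Measurable ((ball z ρ).piecewise F 0) :=
      ContinuousOn.measurable_piecewise hF.continuousOn continuousOn_const measurableSet_ball
    convert this.enorm using 1
    ext w
    by_cases hw : w ∈ ball z ρ <;> simp [hH, hw]
  have hcirc : ∀ r ∈ Ioo 0 ρ, ‖F z‖ₑ ≤ ∫⁻ θ in Ioo (-Real.pi) Real.pi,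
      H (z + Complex.polarCoord.symm (r, θ)) := by
    intro r hr
    have h1 : Real.circleAverage F z r = F z := by
      apply DiffContOnCl.circleAverage
      refine DifferentiableOn.diffContOnCl (hF.mono ?_)
      rw [closure_ball _ (by simpa using hr.1.ne'), abs_of_pos hr.1]
      exact closedBall_subset_ball hr.2
    rw [Real.circleAverage_eq_integral_add (-Real.pi),
      intervalIntegral.integral_comp_add_right (fun θ => F (circleMap z r θ))] at h1
    have hpi : (0 : ℝ) < 2 * Real.pi := by positivity
    have hle : ‖((2 * Real.pi)⁻¹ : ℝ)‖ₑ ≤ 1 := by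
      rw [← ofReal_norm, Real.norm_of_nonneg (by positivity)]
      refine ENNReal.ofReal_le_one.2 (inv_le_one_of_one_le₀ ?_)
      linarith [Real.pi_gt_three]
    rw [← h1, enorm_smul, intervalIntegral.integral_of_le (by linarith),
      ← restrict_Ioo_eq_restrict_Ioc]
    refine (mul_le_of_le_one_left' hle).trans ?_
    rw [show 0 + -Real.pi = -Real.pi by ring, show 2 * Real.pi + -Real.pi = Real.pi by ring]
    refine (enorm_integral_le_lintegral_enorm _).trans (le_of_eq ?_)
    congr 1
    ext θ
    have e : z + Complex.polarCoord.symm (r, θ) = circleMap z r θ := by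
      simp [circleMap, Complex.exp_mul_I]
    have hm : circleMap z r θ ∈ ball z ρ := by
      rw [mem_ball, Complex.dist_eq, circleMap_sub_center, norm_circleMap_zero, abs_of_pos hr.1]
      exact hr.2
    simp only [hH, e, indicator_of_mem hm]
  calc ‖F z‖ₑ * ENNReal.ofReal (ρ / 2) ^ 2
      = ∫⁻ r in Ioo (ρ / 2) ρ, ENNReal.ofReal (ρ / 2) * ‖F z‖ₑ := by
        simp [sub_half]; ring
    _ ≤ ∫⁻ r in Ioo (ρ / 2) ρ, ENNReal.ofReal r * ∫⁻ θ in Ioo (-Real.pi) Real.pi,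
          H (z + Complex.polarCoord.symm (r, θ)) := by
        refine setLIntegral_mono' measurableSet_Ioo fun r hr => ?_
        exact mul_le_mul' (ENNReal.ofReal_le_ofReal hr.1.le) (hcirc r ⟨by linarith [hr.1], hr.2⟩)
    _ ≤ ∫⁻ r in Ioi 0, ENNReal.ofReal r * ∫⁻ θ in Ioo (-Real.pi) Real.pi,
          H (z + Complex.polarCoord.symm (r, θ)) :=
        lintegral_mono_set fun r hr => lt_trans (half_pos hρ) hr.1
    _ = ∫⁻ p in polarCoord.target, ENNReal.ofReal p.1 •
          H (z + Complex.polarCoord.symm p) := by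
        have hm : Measurable fun p : ℝ × ℝ => ENNReal.ofReal p.1 •
            H (z + Complex.polarCoord.symm p) := by
          refine (ENNReal.measurable_ofReal.comp measurable_fst).mul (hmeas.comp ?_)
          simp only [Complex.polarCoord_symm_apply]
          fun_prop
        rw [polarCoord_target, Measure.volume_eq_prod, ← Measure.prod_restrict,
          lintegral_prod _ hm.aemeasurable]
        congr 1
        ext r
        simp only [smul_eq_mul]
        rw [lintegral_const_mul]
        refine hmeas.comp ?_
        simp only [Complex.polarCoord_symm_apply]
        fun_prop
    _ = ∫⁻ w, H (z + w) :=
        Complex.lintegral_comp_polarCoord_symm fun w => H (z + w)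
    _ = ∫⁻ w in ball z ρ, ‖F w‖ₑ := by
        rw [lintegral_add_left_eq_self, lintegral_indicator measurableSet_ball]

theorem areaDensity_pos (α : ℝ) {z : ℂ} (hz : z ∈ ball (0 : ℂ) 1) : 0 < areaDensity α z := by
  have h1 : ‖z‖ < 1 := by simpa using hz
  have h2 : 0 < 1 - ‖z‖ ^ 2 := by nlinarith [norm_nonneg z]
  unfold areaDensity
  have : 0 < (open Classical in if -1 < α then α + 1 else 1 : ℝ) := by
    split_ifs with h <;> linarith
  exact mul_pos (div_pos this Real.pi_pos) (Real.rpow_pos_of_pos h2 _)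

theorem continuousOn_areaDensity (α : ℝ) : ContinuousOn (areaDensity α) (ball 0 1) := by
  unfold areaDensity
  refine continuousOn_const.mul (ContinuousOn.rpow_const (by fun_prop) fun z hz => Or.inl ?_)
  have h1 : ‖z‖ < 1 := by simpa using hz
  nlinarith [norm_nonneg z]

theorem measurable_areaDensity (α : ℝ) : Measurable (areaDensity α) := by
  unfold areaDensity
  fun_prop

/-- On a smaller concentric disk, an analytic function is bounded by its `L²(A_α)` norm. -/
theorem exists_pointwise_bound (α : ℝ) {s : ℝ} (hs : 0 < s) (hs1 : s < 1) :
    ∃ C : ℝ≥0∞, C ≠ ∞ ∧ ∀ F : ℂ → ℂ, DifferentiableOn ℂ F (ball 0 1) →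
      ∀ z ∈ closedBall (0 : ℂ) s, ‖F z‖ₑ ^ 2 ≤ C * eLpNorm F 2 (weightedArea α) ^ 2 := by
  set t : ℝ := (1 + s) / 2 with ht
  have hsub : closedBall (0 : ℂ) t ⊆ ball 0 1 := closedBall_subset_ball (by linarith)
  obtain ⟨w₀, hw₀, hmin⟩ := (isCompact_closedBall (0 : ℂ) t).exists_isMinOn
    ⟨0, by simp; linarith⟩ ((continuousOn_areaDensity α).mono hsub)
  set m := areaDensity α w₀ with hm
  have hmpos : 0 < m := areaDensity_pos α (hsub hw₀)
  have hρ : 0 < t - s := by linarith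
  set D : ℝ≥0∞ := ENNReal.ofReal ((t - s) / 2) ^ 2 with hD
  have hD0 : D ≠ 0 := by simp [hD]; linarith
  have hDt : D ≠ ∞ := by simp [hD]
  refine ⟨D⁻¹ * ENNReal.ofReal m⁻¹, ENNReal.mul_ne_top (ENNReal.inv_ne_top.2 hD0) (by simp), ?_⟩
  intro F hF z hz
  have hball : ball z (t - s) ⊆ closedBall 0 t := by
    refine ball_subset_closedBall.trans (closedBall_subset_closedBall' ?_)
    have : dist z 0 ≤ s := hz
    linarith
  have h1 := areaMean (F := fun w => F w ^ 2) hρ ((hF.mono (hball.trans hsub)).pow 2)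
  have h2 : eLpNorm F 2 (weightedArea α) ^ 2 = ∫⁻ w, ‖F w‖ₑ ^ 2 ∂weightedArea α := by
    have := eLpNorm_nnreal_pow_eq_lintegral (f := F) (μ := weightedArea α) (p := 2) (by norm_num)
    simpa using this
  have h3 : ∫⁻ w in ball z (t - s), ‖F w ^ 2‖ₑ ≤
      ENNReal.ofReal m⁻¹ * ∫⁻ w, ‖F w‖ₑ ^ 2 ∂weightedArea α := by
    rw [weightedArea, lintegral_withDensity_eq_lintegral_mul₀
      (measurable_areaDensity α).ennreal_ofReal.aemeasurable
      ((hF.continuousOn.aemeasurable measurableSet_ball).enorm.pow_const 2),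
      ← lintegral_const_mul' _ _ (by simp)]
    refine (setLIntegral_mono' measurableSet_ball fun w hw => ?_).trans
      (lintegral_mono_set (hball.trans hsub))
    have hmw : m ≤ areaDensity α w := hmin (hball hw)
    simp only [Pi.mul_apply, enorm_pow]
    rw [← mul_assoc, ← ENNReal.ofReal_mul (by positivity)]
    refine le_mul_of_one_le_left' (ENNReal.one_le_ofReal.2 ?_)
    rw [inv_mul_eq_div, one_le_div hmpos]
    exact hmw
  simp only [enorm_pow] at h1 h3
  rw [h2, mul_assoc]
  calc ‖F z‖ₑ ^ 2 = D⁻¹ * (‖F z‖ₑ ^ 2 * D) := by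
        rw [mul_comm, mul_assoc, ENNReal.mul_inv_cancel hD0 hDt, mul_one]
    _ ≤ _ := mul_le_mul_right (h1.trans h3) _

theorem isClosed_bergman (α : ℝ) : IsClosed (bergman α : Set (Lp ℂ 2 (weightedArea α))) := by
  refine IsSeqClosed.isClosed fun f g hf hfg => ?_
  choose F hF hfF using hf
  have hcauchy : CauchySeq f := hfg.cauchySeq
  have hunif : ∀ s : ℝ, 0 < s → s < 1 → UniformCauchySeqOn F atTop (closedBall 0 s) := by
    intro s hs hs1
    obtain ⟨C, hC, hb⟩ := exists_pointwise_bound α hs hs1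
    rw [Metric.uniformCauchySeqOn_iff]
    intro ε hε
    obtain ⟨N, hN⟩ := Metric.cauchySeq_iff.1 hcauchy (ε / (C.toReal + 1)) (by positivity)
    refine ⟨N, fun m hm n hn z hz => ?_⟩
    have h1 := hb (F m - F n) ((hF m).sub (hF n)) z hz
    have h2 : eLpNorm (F m - F n) 2 (weightedArea α) = edist (f m) (f n) := by
      rw [Lp.edist_def]
      exact eLpNorm_congr_ae ((hfF m).symm.sub (hfF n).symm)
    have h3 : dist (F m z) (F n z) ^ 2 ≤ C.toReal * dist (f m) (f n) ^ 2 := by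
      have h4 := ENNReal.toReal_mono (by rw [h2]; finiteness) h1
      rw [h2] at h4
      simpa [ENNReal.toReal_mul, ENNReal.toReal_pow, dist_edist, edist_eq_enorm_sub] using h4
    have h5 := hN m hm n hn
    have hc : 0 ≤ C.toReal := ENNReal.toReal_nonneg
    have h6 : C.toReal * dist (f m) (f n) ^ 2 ≤ (C.toReal + 1) ^ 2 * dist (f m) (f n) ^ 2 := by
      gcongr
      nlinarith
    have h7 : (C.toReal + 1) * dist (f m) (f n) < ε := by
      rwa [lt_div_iff₀' (by positivity)] at h5
    refine lt_of_le_of_lt (abs_le_of_sq_le_sq' ?_ (by positivity)).2 h7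
    rw [mul_pow]
    exact h3.trans h6
  have hlim : ∀ z ∈ ball (0 : ℂ) 1, ∃ y, Tendsto (fun n => F n z) atTop (𝓝 y) := by
    intro z hz
    have hz1 : ‖z‖ < 1 := by simpa using hz
    have h := hunif ((1 + ‖z‖) / 2) (by positivity) (by linarith)
    exact cauchySeq_tendsto_of_complete (h.cauchySeq (by simp; linarith))
  choose! G hG using hlim
  have hloc : TendstoLocallyUniformlyOn F G atTop (ball 0 1) := by
    rw [tendstoLocallyUniformlyOn_iff_forall_isCompact isOpen_ball]
    intro K hK hKc
    obtain ⟨s, hs, hs1, hKs⟩ : ∃ s : ℝ, 0 < s ∧ s < 1 ∧ K ⊆ closedBall 0 s := by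
      obtain ⟨s, ⟨hs, hs1⟩, hKs⟩ := exists_pos_lt_subset_ball one_pos hKc.isClosed hK
      exact ⟨s, hs, hs1, hKs.trans ball_subset_closedBall⟩
    exact ((hunif s hs hs1).mono hKs).tendstoUniformlyOn_of_tendsto fun z hz => hG z (hK hz)
  refine ⟨G, hloc.differentiableOn (Eventually.of_forall hF) isOpen_ball, ?_⟩
  obtain ⟨ns, hns, hae⟩ := (tendstoInMeasure_of_tendsto_Lp hfg).exists_seq_tendsto_ae
  filter_upwards [hae, ae_all_iff.2 hfF, ae_mem_ball α] with z h1 h2 h3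
  simp only [h2] at h1
  exact tendsto_nhds_unique h1 ((hG z h3).comp hns.tendsto_atTop)

instance (α : ℝ) : CompleteSpace (bergman α) := (isClosed_bergman α).completeSpace_coe

/-! ### The operators -/

theorem norm_mul_le_of_mem (α : ℝ) {φ : ℂ → ℂ} (hφ : φ ∈ unitBallHInfty) (f : ℂ → ℂ) :
    ∀ᵐ z ∂weightedArea α, ‖φ z * f z‖ ≤ ‖f z‖ := by
  filter_upwards [ae_mem_ball α] with z hz
  rw [norm_mul]
  exact mul_le_of_le_one_left (norm_nonneg _) (hφ.2 z hz)

theorem memLp_mul (α : ℝ) {φ : ℂ → ℂ} (hφ : φ ∈ unitBallHInfty) (f : Lp ℂ 2 (weightedArea α)) :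
    MemLp (fun z => φ z * f z) 2 (weightedArea α) :=
  (Lp.memLp f).mono ((aestronglyMeasurable_of_differentiableOn α hφ.1).mul
    (Lp.aestronglyMeasurable f)) (norm_mul_le_of_mem α hφ f)

/-- The Toeplitz operator `T_φ f = φ f` on `A²_α`, for `φ` in the unit ball of `H^∞`. -/
def toeplitz (α : ℝ) (φ : ℂ → ℂ) (hφ : φ ∈ unitBallHInfty) : bergman α →L[ℂ] bergman α :=
  LinearMap.mkContinuous
    { toFun := fun f => ⟨(memLp_mul α hφ f).toLp, by
        obtain ⟨F, hF, hfF⟩ := f.2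
        refine ⟨fun z => φ z * F z, hφ.1.mul hF, (memLp_mul α hφ f).coeFn_toLp.trans ?_⟩
        filter_upwards [hfF] with z hz
        rw [hz]⟩
      map_add' := fun f g => by
        ext1
        refine Lp.ext ?_
        filter_upwards [(memLp_mul α hφ (f + g : bergman α)).coeFn_toLp,
          (memLp_mul α hφ f).coeFn_toLp, (memLp_mul α hφ g).coeFn_toLp,
          Lp.coeFn_add (f : Lp ℂ 2 (weightedArea α)) g,
          Lp.coeFn_add (memLp_mul α hφ f).toLp (memLp_mul α hφ g).toLp] with z h1 h2 h3 h4 h5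
        simp only [Submodule.coe_add] at h1 ⊢
        rw [h1, h5, Pi.add_apply, h2, h3, h4, Pi.add_apply, mul_add]
      map_smul' := fun c f => by
        ext1
        refine Lp.ext ?_
        filter_upwards [(memLp_mul α hφ (c • f : bergman α)).coeFn_toLp,
          (memLp_mul α hφ f).coeFn_toLp,
          Lp.coeFn_smul c (f : Lp ℂ 2 (weightedArea α)),
          Lp.coeFn_smul c (memLp_mul α hφ f).toLp] with z h1 h2 h4 h5
        simp only [Submodule.coe_smul, RingHom.id_apply] at h1 ⊢
        rw [h1, h5, Pi.smul_apply, h2, h4, Pi.smul_apply, smul_eq_mul, smul_eq_mul]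
        ring }
    1 fun f => by
      rw [one_mul]
      refine Lp.norm_le_norm_of_ae_le ?_
      filter_upwards [(memLp_mul α hφ f).coeFn_toLp, norm_mul_le_of_mem α hφ f] with z h1 h2
      exact (congrArg norm h1).trans_le h2

/-- `E_φ̄ = I - T_φ^* T_φ` on `A²_α`. -/
def defectBar (α : ℝ) (φ : ℂ → ℂ) (hφ : φ ∈ unitBallHInfty) : bergman α →L[ℂ] bergman α :=
  ContinuousLinearMap.id ℂ (bergman α) -
    (ContinuousLinearMap.adjoint (toeplitz α φ hφ)).comp (toeplitz α φ hφ)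

/-- The range of an operator on `A²_α` as a set of functions: the analytic functions on the disk
that represent some element of the range. -/
def rangeFunctions {α : ℝ} (T : bergman α →L[ℂ] bergman α) : Set (ℂ → ℂ) :=
  {F | DifferentiableOn ℂ F (ball 0 1) ∧
    ∃ f : bergman α, (T f : Lp ℂ 2 (weightedArea α)) =ᵐ[weightedArea α] F}

end WeightedBergman

end

noncomputable section

namespace WeightedBergman

local notation "⟪" x ", " y "⟫" => @inner ℂ _ InnerProductSpace.toInner x y

/-! Write `E` for the defect operator of `φ` and `D = shiftDefect α` for that of `z`. Since
monomials are orthogonal with explicit moments, `D` is diagonal with eigenvalues `(α + 1) / (n + α +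
2)` (`coeff_shiftDefect`). Hence `D` is compact and injective, and its range is exactly `A²_{α-2}`
(`rangeFunctions_shiftDefect`).

(d) ⇒ (a): if the range of `E` lies in that of `D`, then `S = D⁻¹E` is bounded by the closed graph
theorem, and `E = DS` is compact.

(b) ⇒ (c): for a Blaschke factor `b` with zero `a`, `1 - |b|² = |g|² (1 - |z|²)` with `g = √(1 -
|a|²) / (1 - ā z)`, so its defect is `T_g^* D T_g`. As `D` inverts the Euler operator `(z d/dz + α +
2) / (α + 1)`, it commutes with multiplications up to a compact factor
(`multiplication_comp_shiftDefect`), which gives `T_g^* D T_g = D(A + K)` with `A = T_g^* T_g`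
coercive and `K` compact. The identity `E_{φψ} = E_ψ + T_ψ^* E_φ T_ψ` (bars omitted) carries this
form to finite products (`FactorsThrough`). Since `E` is injective, so is `A + K`; by the Fredholm
alternative it is onto, and the ranges of `E` and `D` agree.

(a) ⇒ (b): for compact `E` the quotient `⟨k_z, E k_z⟩ / ‖k_z‖²`, with `k_z` the reproducing kernel,
tends to `0` at the circle. It equals `∫ (1 - |φ|²) |k_z|² dA_α / ‖k_z‖²`. If `|φ(z)| ≤ 1 - δ`, the
Schwarz lemma keeps `1 - |φ|²` above `δ/2` on a disk about `z` of radius comparable to `1 - |z|`,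
and the sub-mean value property bounds the quotient below. So `|φ| → 1` at the circle, and dividing
out the zeros shows that `φ` is a finite Blaschke product. -/

/-! ### Taylor coefficients on the unit disk. -/

/-- The `n`-th Taylor coefficient at the origin. -/
def taylorCoeff (F : ℂ → ℂ) (n : ℕ) : ℂ := (n.factorial : ℂ)⁻¹ * iteratedDeriv n F 0

theorem hasSum_taylorCoeff {F : ℂ → ℂ} (hF : DifferentiableOn ℂ F (ball 0 1)) {z : ℂ}
    (hz : z ∈ ball (0 : ℂ) 1) : HasSum (fun n => taylorCoeff F n * z ^ n) (F z) := by
  have := Complex.hasSum_taylorSeries_on_ball hF hz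
  refine this.congr_fun fun n => ?_
  simp only [taylorCoeff, sub_zero, smul_eq_mul]
  ring

/-- Uniqueness of power series: convergence at every real `r < 1` makes the terms tend to zero
there, so the radius is at least one and both series represent `F` at the origin. The coefficient
formulas below follow by exhibiting an expansion. -/
theorem taylorCoeff_eq_of_hasSum {F : ℂ → ℂ} {b : ℕ → ℂ}
    (h : ∀ z ∈ ball (0 : ℂ) 1, HasSum (fun n => b n * z ^ n) (F z)) : taylorCoeff F = b := by
  have hps : HasFPowerSeriesOnBall F (FormalMultilinearSeries.ofScalars ℂ b) 0 1 := by
    refine ⟨?_, one_pos, ?_⟩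
    · refine ENNReal.le_of_forall_nnreal_lt fun r hr => ?_
      refine FormalMultilinearSeries.le_radius_of_tendsto _ (l := 0) ?_
      have hr1 : (r : ℝ) < 1 := by exact_mod_cast hr
      have := (h (r : ℂ) (by simpa using hr1)).summable.tendsto_atTop_zero.norm
      simpa [FormalMultilinearSeries.ofScalars_norm] using this
    · intro y hy
      have hy' : y ∈ ball (0 : ℂ) 1 := by
        simpa [← ENNReal.ofReal_one, Metric.eball_ofReal] using hy
      simpa [FormalMultilinearSeries.ofScalars_apply_eq, mul_comm] using h y hy'
  have hF : DifferentiableOn ℂ F (ball 0 1) := by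
    have := hps.differentiableOn
    rwa [← ENNReal.ofReal_one, Metric.eball_ofReal] at this
  have hps2 : HasFPowerSeriesOnBall F (FormalMultilinearSeries.ofScalars ℂ (taylorCoeff F)) 0 1 := by
    refine ⟨?_, one_pos, ?_⟩
    · refine ENNReal.le_of_forall_nnreal_lt fun r hr => ?_
      refine FormalMultilinearSeries.le_radius_of_tendsto _ (l := 0) ?_
      have hr1 : (r : ℝ) < 1 := by exact_mod_cast hr
      have := (hasSum_taylorCoeff hF (z := (r : ℂ))
        (by simpa using hr1)).summable.tendsto_atTop_zero.norm
      simpa [FormalMultilinearSeries.ofScalars_norm] using this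
    · intro y hy
      have hy' : y ∈ ball (0 : ℂ) 1 := by
        simpa [← ENNReal.ofReal_one, Metric.eball_ofReal] using hy
      simpa [FormalMultilinearSeries.ofScalars_apply_eq, mul_comm] using hasSum_taylorCoeff hF hy'
  have := hps2.hasFPowerSeriesAt.eq_formalMultilinearSeries hps.hasFPowerSeriesAt
  ext n
  have h2 := congrArg (fun p => p.coeff n) this
  simpa [FormalMultilinearSeries.coeff_ofScalars] using h2

theorem eqOn_of_taylorCoeff_eq {F G : ℂ → ℂ} (hF : DifferentiableOn ℂ F (ball 0 1))
    (hG : DifferentiableOn ℂ G (ball 0 1)) (h : ∀ n, taylorCoeff F n = taylorCoeff G n) :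
    EqOn F G (ball 0 1) := fun z hz => by
  have h1 := hasSum_taylorCoeff hF hz
  simp only [h] at h1
  exact h1.unique (hasSum_taylorCoeff hG hz)

theorem taylorCoeff_congr {F G : ℂ → ℂ} (hG : DifferentiableOn ℂ G (ball 0 1))
    (h : EqOn F G (ball 0 1)) : taylorCoeff F = taylorCoeff G :=
  taylorCoeff_eq_of_hasSum fun z hz => by
    rw [h hz]
    exact hasSum_taylorCoeff hG hz

theorem taylorCoeff_add {F G : ℂ → ℂ} (hF : DifferentiableOn ℂ F (ball 0 1))
    (hG : DifferentiableOn ℂ G (ball 0 1)) (n : ℕ) :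
    taylorCoeff (fun z => F z + G z) n = taylorCoeff F n + taylorCoeff G n := by
  refine congrFun (taylorCoeff_eq_of_hasSum (b := fun n => taylorCoeff F n + taylorCoeff G n)
    fun z hz => ?_) n
  simpa [add_mul] using (hasSum_taylorCoeff hF hz).add (hasSum_taylorCoeff hG hz)

theorem taylorCoeff_const_mul {F : ℂ → ℂ} (c : ℂ) (hF : DifferentiableOn ℂ F (ball 0 1)) (n : ℕ) :
    taylorCoeff (fun z => c * F z) n = c * taylorCoeff F n := by
  refine congrFun (taylorCoeff_eq_of_hasSum (b := fun n => c * taylorCoeff F n)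
    fun z hz => ?_) n
  simpa [mul_assoc] using (hasSum_taylorCoeff hF hz).mul_left c

theorem taylorCoeff_id_mul {F : ℂ → ℂ} (hF : DifferentiableOn ℂ F (ball 0 1)) :
    taylorCoeff (fun z => z * F z) = fun n => if n = 0 then 0 else taylorCoeff F (n - 1) := by
  refine taylorCoeff_eq_of_hasSum fun z hz => ?_
  rw [← hasSum_nat_add_iff' 1]
  simpa [pow_succ, mul_assoc, mul_comm z, mul_left_comm z] using
    (hasSum_taylorCoeff hF hz).mul_right z

theorem taylorCoeff_id_mul_zero {F : ℂ → ℂ} (hF : DifferentiableOn ℂ F (ball 0 1)) :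
    taylorCoeff (fun z => z * F z) 0 = 0 := by
  simp [taylorCoeff_id_mul hF]

theorem taylorCoeff_id_mul_succ {F : ℂ → ℂ} (hF : DifferentiableOn ℂ F (ball 0 1)) (n : ℕ) :
    taylorCoeff (fun z => z * F z) (n + 1) = taylorCoeff F n := by
  simp [taylorCoeff_id_mul hF]

theorem taylorCoeff_deriv (F : ℂ → ℂ) (n : ℕ) :
    taylorCoeff (deriv F) n = (n + 1) * taylorCoeff F (n + 1) := by
  have h : (n.factorial : ℂ) ≠ 0 := by exact_mod_cast n.factorial_ne_zero
  have h' : (n + 1 : ℂ) ≠ 0 := by exact_mod_cast n.succ_ne_zero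
  simp only [taylorCoeff, ← iteratedDeriv_succ', Nat.factorial_succ, Nat.cast_mul, Nat.cast_add,
    Nat.cast_one]
  field_simp

theorem taylorCoeff_id_mul_deriv {F : ℂ → ℂ} (hF : DifferentiableOn ℂ F (ball 0 1)) (n : ℕ) :
    taylorCoeff (fun z => z * deriv F z) n = n * taylorCoeff F n := by
  have hd : DifferentiableOn ℂ (deriv F) (ball 0 1) := hF.deriv isOpen_ball
  cases n with
  | zero => simp [taylorCoeff_id_mul_zero hd]
  | succ n => rw [taylorCoeff_id_mul_succ hd, taylorCoeff_deriv]; push_cast; ring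

theorem taylorCoeff_pow (m n : ℕ) :
    taylorCoeff (fun z => z ^ m) n = if n = m then 1 else 0 := by
  refine congrFun (taylorCoeff_eq_of_hasSum (b := fun n => if n = m then 1 else 0)
    fun z hz => ?_) n
  convert hasSum_ite_eq m (z ^ m) using 2 with k
  split_ifs with h
  · simp [h]
  · simp

/-- Cauchy's formula: on `|z| = r` one has `conj z = r² / z`, which turns `conj z ^ n` into `r ^ (2
* n) * z ^ (-n)`. -/
theorem integral_circle {F : ℂ → ℂ} (hF : DifferentiableOn ℂ F (ball 0 1)) {r : ℝ} (hr : 0 < r)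
    (hr1 : r < 1) (n : ℕ) :
    ∫ θ in Ioo (-Real.pi) Real.pi, conj (Complex.polarCoord.symm (r, θ)) ^ n *
      F (Complex.polarCoord.symm (r, θ)) = 2 * Real.pi * r ^ (2 * n) * taylorCoeff F n := by
  have h1 := DifferentiableOn.circleIntegral_one_div_sub_center_pow_smul hr n
    (hF.mono (closedBall_subset_ball hr1))
  have hpi : -Real.pi ≤ Real.pi := by linarith [Real.pi_pos]
  -- Periodicity moves the circle integral from `[0, 2π]` to the angular range of `polarCoord`.
  have hper : Function.Periodic (fun θ : ℝ => deriv (circleMap 0 r) θ •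
      (1 / (circleMap 0 r θ - 0) ^ (n + 1)) • F (circleMap 0 r θ)) (2 * Real.pi) := by
    intro θ
    simp only [deriv_circleMap, (periodic_circleMap 0 r) θ]
  rw [circleIntegral, show (2 * Real.pi : ℝ) = 0 + 2 * Real.pi by ring,
    hper.intervalIntegral_add_eq 0 (-Real.pi),
    show -Real.pi + 2 * Real.pi = Real.pi by ring, intervalIntegral.integral_of_le hpi,
    ← restrict_Ioo_eq_restrict_Ioc] at h1
  have hrc : (r : ℂ) ≠ 0 := by exact_mod_cast hr.ne'
  have e : ∀ θ : ℝ, conj (Complex.polarCoord.symm (r, θ)) ^ n * F (Complex.polarCoord.symm (r, θ))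
      = (r ^ (2 * n) / Complex.I) * (deriv (circleMap 0 r) θ •
      (1 / (circleMap 0 r θ - 0) ^ (n + 1)) • F (circleMap 0 r θ)) := by
    intro θ
    have e1 : Complex.polarCoord.symm (r, θ) = circleMap 0 r θ := by
      simp [circleMap, Complex.exp_mul_I]
    have e2 : conj (circleMap 0 r θ) = r ^ 2 / circleMap 0 r θ := by
      rw [eq_div_iff (circleMap_ne_center hr.ne'), mul_comm, Complex.mul_conj,
        Complex.normSq_eq_norm_sq, norm_circleMap_zero, sq_abs]
      push_cast; ring
    have h0 : circleMap 0 r θ ≠ 0 := circleMap_ne_center hr.ne'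
    rw [e1, e2, deriv_circleMap]
    simp only [smul_eq_mul, sub_zero, div_pow, one_div, pow_succ, pow_mul]
    field_simp
  simp_rw [e]
  rw [integral_const_mul, h1, taylorCoeff, smul_eq_mul]
  field_simp [Complex.I_ne_zero]

/-! ### Polar coordinates -/

theorem areaDensity_congr (α : ℝ) {z w : ℂ} (h : ‖z‖ = ‖w‖) : areaDensity α z = areaDensity α w := by
  simp [areaDensity, h]

/-- The open rectangle of polar coordinates of the (slit) unit disk. -/
def polarRect : Set (ℝ × ℝ) := Ioo 0 1 ×ˢ Ioo (-Real.pi) Real.pi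

theorem measurableSet_polarRect : MeasurableSet polarRect := measurableSet_Ioo.prod measurableSet_Ioo

theorem polarCoord_symm_mem_ball {p : ℝ × ℝ} (hp : p ∈ polarCoord.target) :
    Complex.polarCoord.symm p ∈ ball (0 : ℂ) 1 ↔ p.1 < 1 := by
  rw [mem_ball_zero_iff, Complex.norm_polarCoord_symm, abs_of_pos hp.1]

theorem polarRect_eq : polarRect = polarCoord.target ∩ {p | p.1 < 1} := by
  ext p
  simp only [polarRect, polarCoord_target, mem_prod, mem_Ioo, mem_inter_iff, mem_Ioi]
  simp only [mem_ofPred_eq]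
  tauto

theorem lintegral_weightedArea (α : ℝ) (f : ℂ → ℝ≥0∞) :
    ∫⁻ z, f z ∂weightedArea α = ∫⁻ p in polarRect,
      ENNReal.ofReal (p.1 * areaDensity α p.1) * f (Complex.polarCoord.symm p) := by
  rw [weightedArea, lintegral_withDensity_eq_lintegral_mul_non_measurable _
    (measurable_areaDensity α).ennreal_ofReal (by simp), ← lintegral_indicator measurableSet_ball,
    ← Complex.lintegral_comp_polarCoord_symm, polarRect_eq, inter_comm,
    ← Measure.restrict_restrict (measurableSet_lt measurable_fst measurable_const),
    ← lintegral_indicator (measurableSet_lt measurable_fst measurable_const)]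
  refine setLIntegral_congr_fun polarCoord.open_target.measurableSet fun p hp => ?_
  by_cases h : p.1 < 1
  · rw [indicator_of_mem ((polarCoord_symm_mem_ball hp).2 h), indicator_of_mem (by exact h),
      Pi.mul_apply, areaDensity_congr α (w := (p.1 : ℂ)) (by simp),
      ENNReal.ofReal_mul (le_of_lt hp.1), smul_eq_mul, mul_assoc]
  · rw [indicator_of_notMem (mt (polarCoord_symm_mem_ball hp).1 h), indicator_of_notMem (by exact h),
      smul_zero]

theorem integral_weightedArea (α : ℝ) (f : ℂ → ℂ) :
    ∫ z, f z ∂weightedArea α = ∫ p in polarRect,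
      (p.1 * areaDensity α p.1) • f (Complex.polarCoord.symm p) := by
  rw [weightedArea, integral_withDensity_eq_integral_toReal_smul
    (measurable_areaDensity α).ennreal_ofReal (by simp), ← integral_indicator measurableSet_ball,
    ← Complex.integral_comp_polarCoord_symm, polarRect_eq, inter_comm,
    ← Measure.restrict_restrict (measurableSet_lt measurable_fst measurable_const),
    ← integral_indicator (measurableSet_lt measurable_fst measurable_const)]
  refine setIntegral_congr_fun polarCoord.open_target.measurableSet fun p hp => ?_
  by_cases h : p.1 < 1
  · have hb := (polarCoord_symm_mem_ball hp).2 h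
    rw [indicator_of_mem hb, indicator_of_mem (by exact h),
      ENNReal.toReal_ofReal (areaDensity_pos α hb).le,
      areaDensity_congr α (w := (p.1 : ℂ)) (by simp), smul_smul]
  · rw [indicator_of_notMem (mt (polarCoord_symm_mem_ball hp).1 h), indicator_of_notMem (by exact h),
      smul_zero]

/-! ### Radial moments of the weight. -/

/-- `moment α n = ∫ |z|^{2n} dA_α`, written as a radial integral. -/
def moment (α : ℝ) (n : ℕ) : ℝ :=
  ∫ r in Ioo (0 : ℝ) 1, 2 * Real.pi * (r * areaDensity α r) * r ^ (2 * n)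

theorem integrableOn_polar {α : ℝ} {f : ℂ → ℂ} (hf : ContinuousOn f (ball 0 1))
    (hfi : Integrable f (weightedArea α)) :
    IntegrableOn (fun p : ℝ × ℝ => (p.1 * areaDensity α p.1) • f (Complex.polarCoord.symm p))
      polarRect := by
  have hmaps : MapsTo (fun p : ℝ × ℝ => Complex.polarCoord.symm p) polarRect (ball 0 1) := by
    intro p hp
    rw [polarRect_eq] at hp
    exact (polarCoord_symm_mem_ball hp.1).2 hp.2
  have hmaps2 : MapsTo (fun p : ℝ × ℝ => (p.1 : ℂ)) polarRect (ball 0 1) := by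
    intro p hp
    simp [abs_of_pos hp.1.1, hp.1.2]
  refine ⟨ContinuousOn.aestronglyMeasurable ?_ measurableSet_polarRect, ?_⟩
  · refine ContinuousOn.smul (continuousOn_fst.mul
      ((continuousOn_areaDensity α).comp (by fun_prop) hmaps2)) (hf.comp ?_ hmaps)
    have hc : Continuous fun p : ℝ × ℝ => (p.1 : ℂ) * (Real.cos p.2 + Real.sin p.2 * Complex.I) := by
      fun_prop
    exact (hc.congr fun p => (Complex.polarCoord_symm_apply p).symm).continuousOn
  · have := hfi.2
    rw [HasFiniteIntegral, lintegral_weightedArea] at this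
    rw [HasFiniteIntegral]
    refine lt_of_le_of_lt (le_of_eq (setLIntegral_congr_fun measurableSet_polarRect fun p hp => ?_))
      this
    rw [enorm_smul, Real.enorm_of_nonneg]
    exact mul_nonneg hp.1.1.le (areaDensity_pos α (hmaps2 hp)).le

/-- Fubini in polar coordinates: each circle contributes the same Taylor coefficient, and the radial
factors integrate to the moment. -/
theorem integral_conj_pow_mul {α : ℝ} {F : ℂ → ℂ} (hF : DifferentiableOn ℂ F (ball 0 1)) (n : ℕ)
    (hFi : Integrable (fun z => conj z ^ n * F z) (weightedArea α)) :
    ∫ z, conj z ^ n * F z ∂weightedArea α = moment α n * taylorCoeff F n := by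
  have hc : ContinuousOn (fun z => conj z ^ n * F z) (ball 0 1) :=
    ((Complex.continuous_conj.pow n).continuousOn).mul hF.continuousOn
  have hi := integrableOn_polar hc hFi
  rw [integral_weightedArea, polarRect, Measure.volume_eq_prod, setIntegral_prod _ (by
    simpa [polarRect, Measure.volume_eq_prod] using hi), moment, ← integral_complex_ofReal,
    ← integral_mul_const]
  refine setIntegral_congr_fun measurableSet_Ioo fun r hr => ?_
  dsimp only
  rw [integral_smul, integral_circle hF hr.1 hr.2]
  simp
  ring

theorem areaDensity_ofReal {α : ℝ} (hα : -1 < α) (r : ℝ) :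
    areaDensity α r = (α + 1) / Real.pi * (1 - r ^ 2) ^ α := by
  simp [areaDensity, hα]

theorem one_sub_sq_pos {r : ℝ} (hr : r ∈ Ioo (0 : ℝ) 1) : 0 < 1 - r ^ 2 := by
  nlinarith [hr.1, hr.2]

theorem hasDerivAt_one_sub_sq_rpow {r : ℝ} (hr : r ∈ Ioo (0 : ℝ) 1) (p : ℝ) :
    HasDerivAt (fun r : ℝ => (1 - r ^ 2) ^ (p + 1)) (-2 * (p + 1) * (r * (1 - r ^ 2) ^ p)) r := by
  have h1 : HasDerivAt (fun r : ℝ => 1 - r ^ 2) (-(2 * r)) r := by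
    simpa using (hasDerivAt_pow 2 r).const_sub 1
  convert h1.rpow_const (p := p + 1) (Or.inl (one_sub_sq_pos hr).ne') using 1
  rw [add_sub_cancel_right]
  ring

theorem continuous_one_sub_sq_rpow {p : ℝ} (hp : 0 < p) :
    Continuous fun r : ℝ => (1 - r ^ 2) ^ p :=
  (by fun_prop : Continuous fun r : ℝ => 1 - r ^ 2).rpow_const fun _ => Or.inr hp.le

/-- For `α < 0` the density blows up at `r = 1`. Integrability comes from the increasing primitive
`-(1 - r²)^(α+1)`, which is continuous up to the endpoint because `α > -1`. -/
theorem integrableOn_radial {α : ℝ} (hα : -1 < α) (n : ℕ) :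
    IntegrableOn (fun r : ℝ => 2 * Real.pi * (r * areaDensity α r) * r ^ (2 * n)) (Ioo 0 1) := by
  have h0 : IntegrableOn (fun r : ℝ => -2 * (α + 1) * (r * (1 - r ^ 2) ^ α)) (Ioo 0 1) := by
    have := intervalIntegral.integrableOn_deriv_of_nonneg (a := (0 : ℝ)) (b := 1)
      (g := fun r : ℝ => -(1 - r ^ 2) ^ (α + 1))
      (g' := fun r => -(-2 * (α + 1) * (r * (1 - r ^ 2) ^ α)))
      (continuous_one_sub_sq_rpow (by linarith)).neg.continuousOn
      (fun r hr => (hasDerivAt_one_sub_sq_rpow hr α).neg)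
      (fun r hr => by
        have h1 := mul_pos hr.1 (Real.rpow_pos_of_pos (one_sub_sq_pos hr) α)
        nlinarith)
    exact (this.mono_set Ioo_subset_Ioc_self).neg.congr_fun (fun r _ => by simp) measurableSet_Ioo
  have h1 : IntegrableOn (fun r : ℝ => 2 * Real.pi * (r * areaDensity α r)) (Ioo 0 1) := by
    refine IntegrableOn.congr_fun (h0.const_mul (-1)) (fun r _ => ?_) measurableSet_Ioo
    rw [areaDensity_ofReal hα]
    field_simp
  refine h1.mul_bdd (c := 1) (by fun_prop) ?_
  refine (ae_restrict_mem measurableSet_Ioo).mono fun r hr => ?_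
  rw [Real.norm_of_nonneg (pow_nonneg hr.1.le _)]
  exact pow_le_one₀ hr.1.le hr.2.le

theorem isFiniteMeasure_weightedArea {α : ℝ} (hα : -1 < α) : IsFiniteMeasure (weightedArea α) := by
  have h0 : IntegrableOn (fun r : ℝ => r * areaDensity α r) (Ioo 0 1) := by
    refine IntegrableOn.congr_fun ((integrableOn_radial hα 0).const_mul (2 * Real.pi)⁻¹) (fun r _ => ?_)
      measurableSet_Ioo
    field_simp
    simp
  have h1 : IntegrableOn (fun p : ℝ × ℝ => p.1 * areaDensity α p.1) polarRect := by
    rw [IntegrableOn, polarRect, Measure.volume_eq_prod, ← Measure.prod_restrict]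
    exact Integrable.comp_fst h0 _
  refine ⟨?_⟩
  rw [← lintegral_one, lintegral_weightedArea]
  refine lt_of_le_of_lt (lintegral_mono fun p => ?_) h1.2
  rw [mul_one]
  exact Real.ofReal_le_enorm _

theorem moment_pos {α : ℝ} (hα : -1 < α) (n : ℕ) : 0 < moment α n := by
  have hpos : ∀ r ∈ Ioo (0 : ℝ) 1, 0 < 2 * Real.pi * (r * areaDensity α r) * r ^ (2 * n) := by
    intro r hr
    have := areaDensity_pos α (z := (r : ℂ)) (by simpa [abs_of_pos hr.1] using hr.2)
    have := hr.1
    positivity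
  rw [moment, setIntegral_pos_iff_support_of_nonneg_ae
    ((ae_restrict_mem measurableSet_Ioo).mono fun r hr => (hpos r hr).le)
    (integrableOn_radial hα n)]
  refine lt_of_lt_of_le ?_ (measure_mono (s := Ioo (0 : ℝ) 1) fun r hr => ⟨(hpos r hr).ne', hr⟩)
  simp

theorem moment_succ {α : ℝ} (hα : -1 < α) (n : ℕ) :
    (n + α + 2) * moment α (n + 1) = (n + 1) * moment α n := by
  have hi := ((integrableOn_radial hα n).const_mul (n + 1 : ℝ)).sub
    ((integrableOn_radial hα (n + 1)).const_mul (n + α + 2))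
  have key : ∫ r in Ioo (0 : ℝ) 1,
      ((n + 1 : ℝ) * (2 * Real.pi * (r * areaDensity α r) * r ^ (2 * n)) -
        (n + α + 2) * (2 * Real.pi * (r * areaDensity α r) * r ^ (2 * (n + 1)))) = 0 := by
    rw [← integral_Ioc_eq_integral_Ioo, ← intervalIntegral.integral_of_le zero_le_one]
    rw [intervalIntegral.integral_eq_sub_of_hasDerivAt_of_le zero_le_one
      -- Integration by parts in disguise: this primitive vanishes at both endpoints, and its
      -- derivative is the difference of the two integrands.
      (f := fun r : ℝ => (α + 1) * (r ^ (2 * n + 2) * (1 - r ^ 2) ^ (α + 1)))]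
    · simp [Real.zero_rpow (by linarith : α + 1 ≠ 0)]
    · exact (continuous_const.mul ((continuous_pow _).mul
        (continuous_one_sub_sq_rpow (by linarith)))).continuousOn
    · intro r hr
      have h := ((hasDerivAt_pow (2 * n + 2) r).mul
        (hasDerivAt_one_sub_sq_rpow hr α)).const_mul (α + 1)
      refine h.congr_deriv ?_
      rw [areaDensity_ofReal hα, Real.rpow_add_one (one_sub_sq_pos hr).ne']
      push_cast
      field_simp
      ring_nf
    · rw [intervalIntegrable_iff_integrableOn_Ioo_of_le zero_le_one]
      exact hi
  rw [integral_sub ((integrableOn_radial hα n).const_mul _)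
    ((integrableOn_radial hα (n + 1)).const_mul _), integral_const_mul, integral_const_mul] at key
  simp only [moment]
  linarith

/-- Both sides satisfy the recursion of `moment_succ` for the exponent `α - 2`, so they are
proportional; the constant is fixed at `n = 0`. -/
theorem moment_sub_two {α : ℝ} (hα : 1 < α) :
    ∃ C : ℝ, 0 < C ∧ ∀ n : ℕ, moment (α - 2) n = C * ((n + α) * (n + α + 1) * moment α n) := by
  have hα1 : -1 < α := by linarith
  have hα2 : -1 < α - 2 := by linarith
  have h0 := moment_pos hα1 0
  have h1 := moment_pos hα2 0
  refine ⟨moment (α - 2) 0 / (α * (α + 1) * moment α 0), by positivity, fun n => ?_⟩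
  induction n with
  | zero => simp; field_simp
  | succ n ih =>
    have e1 := moment_succ hα1 n
    have e2 := moment_succ hα2 n
    have hn : (0 : ℝ) ≤ n := n.cast_nonneg
    have hp : 0 < n + (α - 2) + 2 := by linarith
    have hp2 : 0 < n + α + 2 := by linarith
    refine mul_left_cancel₀ hp.ne' ?_
    rw [e2, ih]
    push_cast
    have : moment α (n + 1) = (n + 1) * moment α n / (n + α + 2) := by
      rw [← e1]; field_simp
    rw [this]
    field_simp
    ring

/-! ### Analytic representatives of elements of the Bergman space. -/

variable {α : ℝ}

/-- The analytic representative of an element of `A²_α`. -/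
def analyticRep (f : bergman α) : ℂ → ℂ := f.2.choose

theorem differentiableOn_analyticRep (f : bergman α) :
    DifferentiableOn ℂ (analyticRep f) (ball 0 1) := f.2.choose_spec.1

theorem ae_eq_analyticRep (f : bergman α) :
    (f : Lp ℂ 2 (weightedArea α)) =ᵐ[weightedArea α] analyticRep f := f.2.choose_spec.2

theorem exists_pointwise_bound_at (α : ℝ) {z : ℂ} (hz : z ∈ ball (0 : ℂ) 1) :
    ∃ C : ℝ≥0∞, C ≠ ∞ ∧ ∀ F : ℂ → ℂ, DifferentiableOn ℂ F (ball 0 1) →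
      ‖F z‖ₑ ^ 2 ≤ C * eLpNorm F 2 (weightedArea α) ^ 2 := by
  have h1 : ‖z‖ < 1 := by simpa using hz
  obtain ⟨C, hC, h⟩ := exists_pointwise_bound α (s := (1 + ‖z‖) / 2) (by positivity) (by linarith)
  exact ⟨C, hC, fun F hF => h F hF z (by simp; linarith)⟩

/-- Point evaluations are bounded by the `L²` norm, which is zero for `F - G`. -/
theorem eqOn_of_ae_eq {F G : ℂ → ℂ} (hF : DifferentiableOn ℂ F (ball 0 1))
    (hG : DifferentiableOn ℂ G (ball 0 1)) (h : F =ᵐ[weightedArea α] G) :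
    EqOn F G (ball 0 1) := fun z hz => by
  obtain ⟨C, -, hC⟩ := exists_pointwise_bound_at α hz
  have h1 := hC (F - G) (hF.sub hG)
  have h2 : eLpNorm (F - G) 2 (weightedArea α) = 0 := by
    rw [eLpNorm_congr_ae (g := 0) (h.mono fun x hx => by simp [hx]), eLpNorm_zero]
  rw [h2] at h1
  simpa [sub_eq_zero] using h1

theorem eqOn_analyticRep {f : bergman α} {F : ℂ → ℂ} (hF : DifferentiableOn ℂ F (ball 0 1))
    (h : (f : Lp ℂ 2 (weightedArea α)) =ᵐ[weightedArea α] F) :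
    EqOn (analyticRep f) F (ball 0 1) :=
  eqOn_of_ae_eq (differentiableOn_analyticRep f) hF ((ae_eq_analyticRep f).symm.trans h)

theorem ext_analyticRep {f g : bergman α} (h : EqOn (analyticRep f) (analyticRep g) (ball 0 1)) :
    f = g := by
  refine Subtype.ext (Lp.ext ?_)
  filter_upwards [ae_eq_analyticRep f, ae_eq_analyticRep g, ae_mem_ball α] with z h1 h2 h3
  rw [h1, h2, h h3]

theorem analyticRep_add (f g : bergman α) {z : ℂ} (hz : z ∈ ball (0 : ℂ) 1) :
    analyticRep (f + g) z = analyticRep f z + analyticRep g z := by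
  refine eqOn_analyticRep (F := fun z => analyticRep f z + analyticRep g z)
    ((differentiableOn_analyticRep f).add (differentiableOn_analyticRep g)) ?_ hz
  filter_upwards [ae_eq_analyticRep f, ae_eq_analyticRep g,
    Lp.coeFn_add (f : Lp ℂ 2 (weightedArea α)) g] with z h1 h2 h3
  rw [Submodule.coe_add, h3, Pi.add_apply, h1, h2]

theorem analyticRep_smul (c : ℂ) (f : bergman α) {z : ℂ} (hz : z ∈ ball (0 : ℂ) 1) :
    analyticRep (c • f) z = c * analyticRep f z := by
  refine eqOn_analyticRep (F := fun z => c * analyticRep f z)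
    ((differentiableOn_analyticRep f).const_mul c) ?_ hz
  filter_upwards [ae_eq_analyticRep f,
    Lp.coeFn_smul c (f : Lp ℂ 2 (weightedArea α))] with z h1 h3
  rw [Submodule.coe_smul, h3, Pi.smul_apply, h1, smul_eq_mul]

theorem analyticRep_sub (f g : bergman α) {z : ℂ} (hz : z ∈ ball (0 : ℂ) 1) :
    analyticRep (f - g) z = analyticRep f z - analyticRep g z := by
  rw [sub_eq_add_neg, ← neg_one_smul ℂ, analyticRep_add _ _ hz, analyticRep_smul _ _ hz]
  ring

/-- The element of `A²_α` given by a square integrable analytic function. -/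
def ofAnalytic (F : ℂ → ℂ) (hF : DifferentiableOn ℂ F (ball 0 1))
    (h : MemLp F 2 (weightedArea α)) : bergman α :=
  ⟨h.toLp, F, hF, h.coeFn_toLp⟩

theorem eqOn_ofAnalytic {F : ℂ → ℂ} (hF : DifferentiableOn ℂ F (ball 0 1))
    (h : MemLp F 2 (weightedArea α)) : EqOn (analyticRep (ofAnalytic F hF h)) F (ball 0 1) :=
  eqOn_analyticRep hF h.coeFn_toLp

theorem memLp_analyticRep (f : bergman α) : MemLp (analyticRep f) 2 (weightedArea α) :=
  (Lp.memLp (f : Lp ℂ 2 (weightedArea α))).ae_eq (ae_eq_analyticRep f)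

theorem inner_eq_integral (f g : bergman α) :
    ⟪f, g⟫ = ∫ z, conj (analyticRep f z) * analyticRep g z ∂weightedArea α := by
  rw [Submodule.coe_inner, L2.inner_def]
  refine integral_congr_ae ?_
  filter_upwards [ae_eq_analyticRep f, ae_eq_analyticRep g] with z h1 h2
  rw [h1, h2, RCLike.inner_apply, mul_comm]

theorem norm_sq_eq_integral (f : bergman α) :
    ‖f‖ ^ 2 = ∫ z, ‖analyticRep f z‖ ^ 2 ∂weightedArea α := by
  have h := inner_eq_integral f f
  rw [inner_self_eq_norm_sq_to_K] at h
  have e : ∀ z, conj (analyticRep f z) * analyticRep f z = ((‖analyticRep f z‖ ^ 2 : ℝ) : ℂ) := by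
    intro z
    rw [mul_comm, Complex.mul_conj, Complex.normSq_eq_norm_sq]
  simp_rw [e] at h
  rw [integral_complex_ofReal] at h
  refine Complex.ofReal_injective ?_
  rw [← h]
  push_cast
  rfl

/-! ### The monomial basis and the description of the space by coefficients. -/

theorem memLp_pow (hα : -1 < α) (n : ℕ) : MemLp (fun z : ℂ => z ^ n) 2 (weightedArea α) := by
  have := isFiniteMeasure_weightedArea hα
  refine MemLp.of_bound (aestronglyMeasurable_of_differentiableOn α (by fun_prop)) 1 ?_
  filter_upwards [ae_mem_ball α] with z hz
  rw [norm_pow]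
  exact pow_le_one₀ (norm_nonneg _) (by simpa using (mem_ball_zero_iff.1 hz).le)

/-- The monomial `z ^ n` as an element of `A²_α`. -/
def monomial (hα : -1 < α) (n : ℕ) : bergman α :=
  ofAnalytic (fun z => z ^ n) (by fun_prop) (memLp_pow hα n)

theorem analyticRep_monomial (hα : -1 < α) (n : ℕ) :
    EqOn (analyticRep (monomial hα n)) (fun z => z ^ n) (ball 0 1) :=
  eqOn_ofAnalytic _ _

/-- The Taylor coefficients of an element of `A²_α`. -/
def coeff (f : bergman α) (n : ℕ) : ℂ := taylorCoeff (analyticRep f) n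

theorem coeff_eq {f : bergman α} {F : ℂ → ℂ} (hF : DifferentiableOn ℂ F (ball 0 1))
    (h : EqOn (analyticRep f) F (ball 0 1)) (n : ℕ) : coeff f n = taylorCoeff F n :=
  congrFun (taylorCoeff_congr hF h) n

theorem ext_coeff {f g : bergman α} (h : ∀ n, coeff f n = coeff g n) : f = g :=
  ext_analyticRep (eqOn_of_taylorCoeff_eq (differentiableOn_analyticRep f)
    (differentiableOn_analyticRep g) h)

theorem inner_monomial (hα : -1 < α) (n : ℕ) (f : bergman α) :
    ⟪monomial hα n, f⟫ = moment α n * coeff f n := by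
  have e : (fun z => conj (analyticRep (monomial hα n) z) * analyticRep f z) =ᵐ[weightedArea α]
      fun z => conj z ^ n * analyticRep f z := by
    filter_upwards [ae_mem_ball α] with z hz
    rw [analyticRep_monomial hα n hz, map_pow]
  rw [inner_eq_integral, integral_congr_ae e]
  refine integral_conj_pow_mul (differentiableOn_analyticRep f) n ?_
  have h := (memLp_analyticRep (monomial hα n)).star.integrable_mul (memLp_analyticRep f)
  exact h.congr e

theorem coeff_monomial (hα : -1 < α) (m n : ℕ) :
    coeff (monomial hα m) n = if n = m then 1 else 0 := by
  rw [coeff_eq (by fun_prop) (analyticRep_monomial hα m), taylorCoeff_pow]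

/-- The normalized monomials. -/
def unitMonomial (hα : -1 < α) (n : ℕ) : bergman α :=
  (((√(moment α n))⁻¹ : ℝ) : ℂ) • monomial hα n

theorem inner_unitMonomial (hα : -1 < α) (n : ℕ) (f : bergman α) :
    ⟪unitMonomial hα n, f⟫ = √(moment α n) * coeff f n := by
  have h : 0 < √(moment α n) := Real.sqrt_pos.2 (moment_pos hα n)
  refine (inner_smul_left (𝕜 := ℂ) (monomial hα n) f _).trans ?_
  rw [inner_monomial, Complex.conj_ofReal, ← mul_assoc, ← Complex.ofReal_mul]
  congr 2
  rw [inv_mul_eq_div, div_eq_iff h.ne', Real.mul_self_sqrt (moment_pos hα n).le]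

theorem coeff_smul (c : ℂ) (f : bergman α) (n : ℕ) : coeff (c • f) n = c * coeff f n := by
  rw [coeff_eq ((differentiableOn_analyticRep f).const_mul c) fun z hz => analyticRep_smul c f hz,
    taylorCoeff_const_mul _ (differentiableOn_analyticRep f), coeff]

theorem coeff_add (f g : bergman α) (n : ℕ) : coeff (f + g) n = coeff f n + coeff g n := by
  rw [coeff_eq ((differentiableOn_analyticRep f).add (differentiableOn_analyticRep g))
    fun z hz => analyticRep_add f g hz,
    coeff, coeff, ← taylorCoeff_add (differentiableOn_analyticRep f) (differentiableOn_analyticRep g)]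
  rfl

theorem orthonormal_unitMonomial (hα : -1 < α) : Orthonormal ℂ (unitMonomial hα) := by
  rw [orthonormal_iff_ite]
  intro m n
  have h : 0 < √(moment α m) := Real.sqrt_pos.2 (moment_pos hα m)
  rw [inner_unitMonomial, unitMonomial, coeff_smul, coeff_monomial]
  split_ifs with hmn
  · subst hmn
    rw [mul_one, ← Complex.ofReal_mul, mul_inv_cancel₀ h.ne', Complex.ofReal_one]
  · simp

/-- The orthonormal basis of normalized monomials. -/
def monomialBasis (hα : -1 < α) : HilbertBasis ℕ ℂ (bergman α) :=
  HilbertBasis.mkOfOrthogonalEqBot (orthonormal_unitMonomial hα) <| by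
    rw [Submodule.eq_bot_iff]
    intro f hf
    refine ext_coeff fun n => ?_
    have h1 : ⟪unitMonomial hα n, f⟫ = 0 :=
      hf _ (Submodule.subset_span (mem_range_self n))
    have h : (√(moment α n) : ℂ) ≠ 0 := by
      exact_mod_cast (Real.sqrt_pos.2 (moment_pos hα n)).ne'
    rw [inner_unitMonomial] at h1
    have h2 := coeff_smul (0 : ℂ) f n
    rw [zero_smul, zero_mul] at h2
    rw [h2]
    exact (mul_eq_zero.1 h1).resolve_left h

theorem monomialBasis_apply (hα : -1 < α) (n : ℕ) : monomialBasis hα n = unitMonomial hα n := by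
  simp [monomialBasis]

theorem monomialBasis_repr (hα : -1 < α) (f : bergman α) (n : ℕ) :
    (monomialBasis hα).repr f n = √(moment α n) * coeff f n := by
  rw [HilbertBasis.repr_apply_apply, monomialBasis_apply, inner_unitMonomial]

theorem hasSum_norm_sq (hα : -1 < α) (f : bergman α) :
    HasSum (fun n => moment α n * ‖coeff f n‖ ^ 2) (‖f‖ ^ 2) := by
  have h := lp.hasSum_norm (p := 2) (by norm_num) ((monomialBasis hα).repr f)
  rw [LinearIsometryEquiv.norm_map] at h
  simp only [ENNReal.toReal_ofNat, Real.rpow_ofNat, monomialBasis_repr] at h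
  refine h.congr_fun fun n => ?_
  rw [norm_mul, mul_pow, Complex.norm_real, Real.norm_of_nonneg (Real.sqrt_nonneg _),
    Real.sq_sqrt (moment_pos hα n).le]

/-- Riesz–Fischer in the monomial basis. -/
theorem exists_coeff_eq (hα : -1 < α) {a : ℕ → ℂ} (ha : Summable fun n => moment α n * ‖a n‖ ^ 2) :
    ∃ f : bergman α, ∀ n, coeff f n = a n := by
  have hm : Memℓp (fun n => (√(moment α n) : ℂ) * a n) 2 := by
    refine memℓp_gen ?_
    simp only [ENNReal.toReal_ofNat, Real.rpow_ofNat]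
    refine ha.congr fun n => ?_
    rw [norm_mul, mul_pow, Complex.norm_real, Real.norm_of_nonneg (Real.sqrt_nonneg _),
      Real.sq_sqrt (moment_pos hα n).le]
  refine ⟨(monomialBasis hα).repr.symm ⟨_, hm⟩, fun n => ?_⟩
  have h1 := monomialBasis_repr hα ((monomialBasis hα).repr.symm ⟨_, hm⟩) n
  rw [LinearIsometryEquiv.apply_symm_apply] at h1
  have h : (√(moment α n) : ℂ) ≠ 0 := by
    exact_mod_cast (Real.sqrt_pos.2 (moment_pos hα n)).ne'
  exact (mul_left_cancel₀ h h1).symm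

/-- The converse compares `F` with the element that Riesz–Fischer builds from its coefficients. The
criterion turns membership in the spaces with exponents `α` and `α - 2` into weighted summability.
-/
theorem memLp_iff_summable (hα : -1 < α) {F : ℂ → ℂ} (hF : DifferentiableOn ℂ F (ball 0 1)) :
    MemLp F 2 (weightedArea α) ↔ Summable fun n => moment α n * ‖taylorCoeff F n‖ ^ 2 := by
  constructor
  · intro h
    refine (hasSum_norm_sq hα (ofAnalytic F hF h)).summable.congr fun n => ?_
    rw [coeff_eq hF (eqOn_ofAnalytic hF h)]
  · intro h
    obtain ⟨f, hf⟩ := exists_coeff_eq hα h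
    refine (memLp_analyticRep f).ae_eq ?_
    filter_upwards [ae_mem_ball α] with z hz
    exact eqOn_of_taylorCoeff_eq (differentiableOn_analyticRep f) hF hf hz

/-! ### Multiplication operators -/

/-- `M` acts on `A²_α` as multiplication by `g`. -/
def IsMultiplication (g : ℂ → ℂ) (M : bergman α →L[ℂ] bergman α) : Prop :=
  ∀ f, EqOn (analyticRep (M f)) (fun z => g z * analyticRep f z) (ball 0 1)

theorem isMultiplication_toeplitz {φ : ℂ → ℂ} (hφ : φ ∈ unitBallHInfty) :
    IsMultiplication φ (toeplitz α φ hφ) := fun f => by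
  refine eqOn_analyticRep (hφ.1.mul (differentiableOn_analyticRep f)) ?_
  refine (memLp_mul α hφ f).coeFn_toLp.trans ?_
  filter_upwards [ae_eq_analyticRep f] with z hz
  rw [hz]

theorem exists_isMultiplication {g : ℂ → ℂ} (hg : DifferentiableOn ℂ g (ball 0 1)) {C : ℝ}
    (hC : ∀ z ∈ ball (0 : ℂ) 1, ‖g z‖ ≤ C) :
    ∃ M : bergman α →L[ℂ] bergman α, IsMultiplication g M := by
  have hC0 : 0 ≤ C := (norm_nonneg _).trans (hC 0 (by simp))
  have hC1 : (0 : ℝ) < C + 1 := by linarith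
  -- Rescaling puts `g` in the unit ball of `H^∞`; dividing by `C + 1` rather than `C` avoids a zero
  -- denominator.
  have hφ : (fun z => ((C + 1 : ℝ) : ℂ)⁻¹ * g z) ∈ unitBallHInfty := by
    refine ⟨hg.const_mul _, fun z hz => ?_⟩
    rw [norm_mul, norm_inv, Complex.norm_real, Real.norm_of_nonneg hC1.le, inv_mul_le_iff₀ hC1]
    linarith [hC z hz]
  have hne : ((C + 1 : ℝ) : ℂ) ≠ 0 := by exact_mod_cast hC1.ne'
  refine ⟨((C + 1 : ℝ) : ℂ) • toeplitz α _ hφ, fun f z hz => ?_⟩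
  refine (analyticRep_smul _ _ hz).trans ?_
  refine (congrArg _ (isMultiplication_toeplitz hφ f hz)).trans ?_
  field_simp

theorem IsMultiplication.comp {g h : ℂ → ℂ} {M N : bergman α →L[ℂ] bergman α}
    (hM : IsMultiplication g M) (hN : IsMultiplication h N) :
    IsMultiplication (fun z => g z * h z) (M.comp N) := fun f z hz => by
  rw [ContinuousLinearMap.comp_apply, hM _ hz]
  dsimp only
  rw [hN _ hz, mul_assoc]

theorem IsMultiplication.unique {g h : ℂ → ℂ} {M N : bergman α →L[ℂ] bergman α}
    (hM : IsMultiplication g M) (hN : IsMultiplication h N) (hgh : EqOn g h (ball 0 1)) :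
    M = N := by
  ext1 f
  refine ext_analyticRep fun z hz => ?_
  rw [hM f hz, hN f hz]
  dsimp only
  rw [hgh hz]

theorem integrable_norm_sq (f : bergman α) :
    Integrable (fun z => ‖analyticRep f z‖ ^ 2) (weightedArea α) :=
  (memLp_two_iff_integrable_sq_norm (aestronglyMeasurable_of_differentiableOn α
    (differentiableOn_analyticRep f))).1 (memLp_analyticRep f)

theorem IsMultiplication.norm_sq {g : ℂ → ℂ} {M : bergman α →L[ℂ] bergman α}
    (hM : IsMultiplication g M) (f : bergman α) :
    Integrable (fun z => ‖g z‖ ^ 2 * ‖analyticRep f z‖ ^ 2) (weightedArea α) ∧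
      ‖M f‖ ^ 2 = ∫ z, ‖g z‖ ^ 2 * ‖analyticRep f z‖ ^ 2 ∂weightedArea α := by
  have e : (fun z => ‖analyticRep (M f) z‖ ^ 2) =ᵐ[weightedArea α]
      fun z => ‖g z‖ ^ 2 * ‖analyticRep f z‖ ^ 2 := by
    filter_upwards [ae_mem_ball α] with z hz
    rw [hM f hz, norm_mul, mul_pow]
  exact ⟨(integrable_norm_sq (M f)).congr e, by rw [norm_sq_eq_integral, integral_congr_ae e]⟩

/-! ### The defect operators -/

theorem inner_defectBar {φ : ℂ → ℂ} (hφ : φ ∈ unitBallHInfty) (f g : bergman α) :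
    ⟪f, defectBar α φ hφ g⟫ = ⟪f, g⟫ - ⟪toeplitz α φ hφ f, toeplitz α φ hφ g⟫ := by
  have e : defectBar α φ hφ g =
      g - ContinuousLinearMap.adjoint (toeplitz α φ hφ) (toeplitz α φ hφ g) := rfl
  rw [e]
  refine (inner_sub_right (𝕜 := ℂ) f g _).trans ?_
  rw [ContinuousLinearMap.adjoint_inner_right]

/-- The defect operator has the quadratic form of the symbol `1 - |φ|²`. The Blaschke factor
identity, injectivity and the lower bound on kernels all rest on this. -/
theorem re_inner_defectBar {φ : ℂ → ℂ} (hφ : φ ∈ unitBallHInfty) (f : bergman α) :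
    (⟪f, defectBar α φ hφ f⟫ : ℂ) =
      ((∫ z, (1 - ‖φ z‖ ^ 2) * ‖analyticRep f z‖ ^ 2 ∂weightedArea α : ℝ) : ℂ) := by
  have h := (isMultiplication_toeplitz (α := α) hφ).norm_sq f
  have h1 : (⟪f, f⟫ : ℂ) = ((‖f‖ ^ 2 : ℝ) : ℂ) := by
    refine (inner_self_eq_norm_sq_to_K (𝕜 := ℂ) f).trans ?_
    push_cast
    rfl
  have h2 : (⟪toeplitz α φ hφ f, toeplitz α φ hφ f⟫ : ℂ) = ((‖toeplitz α φ hφ f‖ ^ 2 : ℝ) : ℂ) := by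
    refine (inner_self_eq_norm_sq_to_K (𝕜 := ℂ) _).trans ?_
    push_cast
    rfl
  rw [inner_defectBar, h1, h2, ← Complex.ofReal_sub, h.2, norm_sq_eq_integral,
    ← integral_sub (integrable_norm_sq f) h.1]
  simp only [sub_mul, one_mul]

theorem id_mem_unitBallHInfty : (fun z : ℂ => z) ∈ unitBallHInfty :=
  ⟨differentiableOn_id, fun _ hz => (mem_ball_zero_iff.1 hz).le⟩

/-- The defect operator of multiplication by `z`. -/
def shiftDefect (α : ℝ) : bergman α →L[ℂ] bergman α :=
  defectBar α (fun z => z) id_mem_unitBallHInfty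

theorem toeplitz_id_monomial (hα : -1 < α) (n : ℕ) :
    toeplitz α (fun z => z) id_mem_unitBallHInfty (monomial hα n) = monomial hα (n + 1) :=
  ext_analyticRep fun z hz => by
    rw [isMultiplication_toeplitz id_mem_unitBallHInfty _ hz, analyticRep_monomial hα _ hz]
    dsimp only
    rw [analyticRep_monomial hα _ hz, pow_succ, mul_comm]

theorem coeff_toeplitz_id_succ (f : bergman α) (n : ℕ) :
    coeff (toeplitz α (fun z => z) id_mem_unitBallHInfty f) (n + 1) = coeff f n := by
  rw [coeff_eq (differentiableOn_id.mul (differentiableOn_analyticRep f))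
    (isMultiplication_toeplitz id_mem_unitBallHInfty f)]
  exact taylorCoeff_id_mul_succ (differentiableOn_analyticRep f) n

/-- The form is diagonal in monomials, and the eigenvalue is `1 - moment α (n + 1) / moment α n`. -/
theorem coeff_shiftDefect (hα : -1 < α) (f : bergman α) (n : ℕ) :
    coeff (shiftDefect α f) n = ((α + 1) / (n + α + 2) : ℝ) * coeff f n := by
  have h := inner_defectBar id_mem_unitBallHInfty (monomial hα n) f
  rw [toeplitz_id_monomial, inner_monomial, inner_monomial, inner_monomial,
    coeff_toeplitz_id_succ, ← sub_mul] at h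
  have hm := moment_pos hα n
  have hn : (0 : ℝ) ≤ n := n.cast_nonneg
  have h1 : moment α (n + 1) = (n + 1) / (n + α + 2) * moment α n := by
    have := moment_succ hα n
    have : (n + α + 2 : ℝ) ≠ 0 := by linarith
    field_simp
    linarith
  have h2 : (moment α n : ℂ) ≠ 0 := by exact_mod_cast hm.ne'
  refine mul_left_cancel₀ h2 (h.trans ?_)
  rw [h1, ← mul_assoc, ← Complex.ofReal_sub, ← Complex.ofReal_mul]
  congr 2
  have : (n + α + 2 : ℝ) ≠ 0 := by linarith
  field_simp
  ring

/-- The orthogonal projection onto the polynomials of degree less than `N`. -/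
def truncation (hα : -1 < α) (N : ℕ) : bergman α →L[ℂ] bergman α :=
  ∑ n ∈ Finset.range N, (ContinuousLinearMap.toSpanSingleton ℂ (unitMonomial hα n)).comp
    (innerSL ℂ (unitMonomial hα n))

/-- The `n`-th Taylor coefficient as a linear functional. -/
def coeffLinear (α : ℝ) (n : ℕ) : bergman α →ₗ[ℂ] ℂ where
  toFun f := coeff f n
  map_add' f g := coeff_add f g n
  map_smul' c f := coeff_smul c f n

theorem coeff_truncation (hα : -1 < α) (N : ℕ) (f : bergman α) (n : ℕ) :
    coeff (truncation hα N f) n = if n < N then coeff f n else 0 := by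
  have e : truncation hα N f =
      ∑ k ∈ Finset.range N, (⟪unitMonomial hα k, f⟫ : ℂ) • unitMonomial hα k := by
    rw [truncation, sum_apply]
    rfl
  have e2 : ∀ k, coeffLinear α n ((⟪unitMonomial hα k, f⟫ : ℂ) • unitMonomial hα k) =
      if n = k then coeff f n else 0 := by
    intro k
    have h : (√(moment α k) : ℂ) ≠ 0 := by
      exact_mod_cast (Real.sqrt_pos.2 (moment_pos hα k)).ne'
    refine (coeff_smul _ _ n).trans ?_
    rw [inner_unitMonomial, unitMonomial, coeff_smul, coeff_monomial]
    split_ifs with hk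
    · subst hk
      push_cast
      field_simp
    · simp
  change coeffLinear α n (truncation hα N f) = _
  rw [e, map_sum, Finset.sum_congr rfl fun k _ => e2 k]
  simp

theorem isCompactOperator_truncation (hα : -1 < α) (N : ℕ) :
    IsCompactOperator (truncation hα N) := by
  unfold truncation
  induction N with
  | zero => simpa using isCompactOperator_zero
  | succ N ih =>
    rw [Finset.sum_range_succ]
    refine ih.add ?_
    exact (isCompactOperator_of_locallyCompactSpace_rng
      (ContinuousLinearMap.toSpanSingleton ℂ (unitMonomial hα N))).comp_clm _

/-- A norm limit of finite-rank truncations: the eigenvalues decrease to zero, so the error past `N`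
is at most the `N`-th one. -/
theorem isCompactOperator_shiftDefect (hα : -1 < α) : IsCompactOperator (shiftDefect α) := by
  have hlim : Tendsto (fun N => (shiftDefect α).comp (truncation hα N)) atTop
      (𝓝 (shiftDefect α)) := by
    refine (tendsto_iff_norm_sub_tendsto_zero (E := bergman α →L[ℂ] bergman α)).2 ?_
    have h0 : Tendsto (fun N : ℕ => (α + 1) / (N + α + 2)) atTop (𝓝 0) := by
      refine Tendsto.div_atTop tendsto_const_nhds ?_
      simp only [add_assoc]
      exact tendsto_atTop_add_const_right _ _ tendsto_natCast_atTop_atTop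
    refine squeeze_zero (fun _ => ContinuousLinearMap.opNorm_nonneg _) (fun N => ?_) h0
    have hN : (0 : ℝ) ≤ N := N.cast_nonneg
    have hl : 0 ≤ (α + 1) / (N + α + 2) := div_nonneg (by linarith) (by linarith)
    refine ContinuousLinearMap.opNorm_le_bound _ hl fun f => ?_
    refine abs_le_of_sq_le_sq' ?_ (by positivity) |>.2
    rw [mul_pow]
    refine hasSum_le (fun n => ?_) (hasSum_norm_sq hα _)
      ((hasSum_norm_sq hα f).mul_left (((α + 1) / (N + α + 2)) ^ 2))
    have e : coeff (((shiftDefect α).comp (truncation hα N) - shiftDefect α) f) n =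
        ((α + 1) / (n + α + 2) : ℝ) * (if n < N then 0 else - coeff f n) := by
      change coeffLinear α n (shiftDefect α (truncation hα N f) - shiftDefect α f) = _
      rw [map_sub]
      change coeff _ n - coeff _ n = _
      rw [coeff_shiftDefect hα, coeff_shiftDefect hα, coeff_truncation]
      split_ifs <;> ring
    rw [e]
    have hm := (moment_pos hα n).le
    split_ifs with h
    · rw [mul_zero, norm_zero, zero_pow two_ne_zero, mul_zero]
      positivity
    · have hn : (N : ℝ) ≤ n := by exact_mod_cast not_lt.1 h
      have hln : 0 ≤ (α + 1) / (n + α + 2) := div_nonneg (by linarith) (by linarith)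
      have hle : (α + 1) / (n + α + 2) ≤ (α + 1) / (N + α + 2) :=
        div_le_div_of_nonneg_left (by linarith) (by linarith) (by linarith)
      rw [norm_mul, Complex.norm_real, Real.norm_of_nonneg hln, norm_neg, mul_pow]
      rw [mul_left_comm]
      gcongr
  exact isCompactOperator_of_tendsto hlim
    (Eventually.of_forall fun N => (isCompactOperator_truncation hα N).clm_comp (shiftDefect α))

/-! ### The range of the defect operator of the shift -/

theorem mem_rangeFunctions_iff {T : bergman α →L[ℂ] bergman α} {F : ℂ → ℂ} :
    F ∈ rangeFunctions T ↔ DifferentiableOn ℂ F (ball 0 1) ∧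
      ∃ f, EqOn (analyticRep (T f)) F (ball 0 1) := by
  refine and_congr_right fun hF => exists_congr fun f => ⟨eqOn_analyticRep hF, fun h => ?_⟩
  filter_upwards [ae_eq_analyticRep (T f), ae_mem_ball α] with z h1 h2
  rw [h1, h h2]

theorem mem_rangeFunctions_shiftDefect (hα : -1 < α) {F : ℂ → ℂ} :
    F ∈ rangeFunctions (shiftDefect α) ↔ DifferentiableOn ℂ F (ball 0 1) ∧
      Summable fun n : ℕ => (n + α + 2) ^ 2 * (moment α n * ‖taylorCoeff F n‖ ^ 2) := by
  rw [mem_rangeFunctions_iff]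
  have hpos : ∀ n : ℕ, (0 : ℝ) < n + α + 2 := fun n => by
    have : (0 : ℝ) ≤ n := n.cast_nonneg
    linarith
  have hα1 : 0 < α + 1 := by linarith
  refine and_congr_right fun hF => ⟨?_, fun h => ?_⟩
  · rintro ⟨f, hf⟩
    refine ((hasSum_norm_sq hα f).summable.mul_left ((α + 1) ^ 2)).congr fun n => ?_
    have := hpos n
    rw [← coeff_eq hF hf, coeff_shiftDefect hα, norm_mul, Complex.norm_real,
      Real.norm_of_nonneg (by positivity)]
    field_simp
  · obtain ⟨f, hf⟩ := exists_coeff_eq hα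
      (a := fun n => ((n + α + 2) / (α + 1) : ℝ) * taylorCoeff F n) (by
        refine (h.mul_left (((α + 1) ^ 2)⁻¹)).congr fun n => ?_
        have := hpos n
        rw [norm_mul, Complex.norm_real, Real.norm_of_nonneg (by positivity)]
        field_simp)
    refine ⟨f, eqOn_of_taylorCoeff_eq (differentiableOn_analyticRep _) hF fun n => ?_⟩
    refine (coeff_shiftDefect hα f n).trans ?_
    have := hpos n
    rw [hf, ← mul_assoc, ← Complex.ofReal_mul, div_mul_div_cancel₀ this.ne', div_self hα1.ne']
    simp

theorem derivOrder_sub_two_of_lt (hα : 1 < α) : derivOrder (α - 2) = 0 := by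
  rw [derivOrder, Nat.sInf_eq_zero]
  left
  simp only [mem_ofPred_eq, Nat.cast_zero]
  linarith

theorem derivOrder_sub_two_of_le (hα : -1 < α) (hα1 : α ≤ 1) : derivOrder (α - 2) = 1 := by
  refine le_antisymm (Nat.sInf_le ?_) (Nat.one_le_iff_ne_zero.2 fun h => ?_)
  · simp only [mem_ofPred_eq, Nat.cast_one]
    linarith
  · rw [derivOrder, Nat.sInf_eq_zero] at h
    rcases h with h | h
    · simp only [mem_ofPred_eq, Nat.cast_zero] at h
      linarith
    · have h1 : (1 : ℕ) ∈ {k : ℕ | -1 < 2 * (k : ℝ) + (α - 2)} := by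
        simp only [mem_ofPred_eq, Nat.cast_one]
        linarith
      rw [h] at h1
      exact h1

theorem integrable_weighted_sub_two_iff (hα : -1 < α) (hα1 : α ≤ 1) (u : ℂ → ℝ) :
    Integrable (fun z => (1 - ‖z‖ ^ 2) ^ 2 * u z) (weightedArea (α - 2)) ↔
      Integrable u (weightedArea α) := by
  rw [weightedArea, weightedArea, integrable_withDensity_iff
    (measurable_areaDensity _).ennreal_ofReal (by simp), integrable_withDensity_iff
    (measurable_areaDensity _).ennreal_ofReal (by simp)]
  have hne : α + 1 ≠ 0 := by linarith
  -- Since `α - 2 ≤ -1`, the measure on the left lacks the normalizing factor `α + 1` present on the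
  -- right.
  rw [← integrable_const_mul_iff (isUnit_iff_ne_zero.2 hne)
    (fun z => (1 - ‖z‖ ^ 2) ^ 2 * u z * (ENNReal.ofReal (areaDensity (α - 2) z)).toReal)]
  refine integrable_congr ((ae_restrict_mem measurableSet_ball).mono fun z hz => ?_)
  dsimp only
  rw [ENNReal.toReal_ofReal (areaDensity_pos _ hz).le,
    ENNReal.toReal_ofReal (areaDensity_pos _ hz).le]
  have h1 : ‖z‖ < 1 := by simpa using hz
  have h2 : 0 < 1 - ‖z‖ ^ 2 := by nlinarith [norm_nonneg z]
  rw [areaDensity, areaDensity, if_neg (by linarith), if_pos hα, Real.rpow_sub h2,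
    Real.rpow_two]
  field_simp

theorem summable_iff_of_le_of_le {u v : ℕ → ℝ} (hu : ∀ n, 0 ≤ u n) (hv : ∀ n, 0 ≤ v n) {c C : ℝ}
    (h1 : ∀ n, u n ≤ c * v n) (h2 : ∀ n, v n ≤ C * u n) : Summable u ↔ Summable v :=
  ⟨fun h => (h.mul_left C).of_nonneg_of_le hv h2, fun h => (h.mul_left c).of_nonneg_of_le hu h1⟩

/-- Both sides are weighted `ℓ²` conditions on Taylor coefficients with weight comparable to `(n + α
+ 2)² * moment α n`. If `α > 1` no derivative occurs and `moment_sub_two` compares the weights;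
otherwise one derivative occurs and `(1 - |z|²)²` restores the exponent `α`. -/
theorem rangeFunctions_shiftDefect (hα : -1 < α) :
    rangeFunctions (shiftDefect α) = genBergman (α - 2) := by
  ext F
  rw [mem_rangeFunctions_shiftDefect hα]
  refine and_congr_right fun hF => ?_
  rcases lt_or_ge 1 α with h | h
  · simp only [derivOrder_sub_two_of_lt h, mul_zero, pow_zero, one_mul, iteratedDeriv_zero]
    rw [← memLp_two_iff_integrable_sq_norm (aestronglyMeasurable_of_differentiableOn _ hF),
      memLp_iff_summable (by linarith) hF]
    obtain ⟨C, hC, hCm⟩ := moment_sub_two h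
    simp only [hCm]
    -- The constant 9 is `3²`: as `n + α ≥ 1`, one has `n + α + 2 ≤ 3 (n + α)`.
    refine summable_iff_of_le_of_le (c := 9 * C⁻¹) (C := C) (fun n => ?_) (fun n => ?_)
      (fun n => ?_) fun n => ?_
    all_goals
      have hm := (moment_pos hα n).le
      have hn : (0 : ℝ) ≤ n := n.cast_nonneg
    · positivity
    · positivity
    · have e : 9 * C⁻¹ * (C * ((n + α) * (n + α + 1) * moment α n) * ‖taylorCoeff F n‖ ^ 2) =
          9 * ((n + α) * (n + α + 1)) * (moment α n * ‖taylorCoeff F n‖ ^ 2) := by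
        field_simp
      rw [e]
      gcongr
      nlinarith
    · rw [mul_assoc C, mul_assoc _ (moment α n)]
      gcongr
      nlinarith
  · simp only [derivOrder_sub_two_of_le hα h, mul_one, iteratedDeriv_one]
    rw [integrable_weighted_sub_two_iff hα h, ← memLp_two_iff_integrable_sq_norm
      (aestronglyMeasurable_of_differentiableOn _ (hF.deriv isOpen_ball)),
      memLp_iff_summable hα (hF.deriv isOpen_ball), ← summable_nat_add_iff 1]
    have hX : ∀ n, 0 ≤ moment α (n + 1) * ‖taylorCoeff F (n + 1)‖ ^ 2 := fun n =>
      mul_nonneg (moment_pos hα _).le (by positivity)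
    have hv : ∀ n : ℕ, moment α n * ‖taylorCoeff (deriv F) n‖ ^ 2 =
        (n + α + 2) * (n + 1) * (moment α (n + 1) * ‖taylorCoeff F (n + 1)‖ ^ 2) := by
      intro n
      rw [taylorCoeff_deriv, norm_mul, mul_pow, ← mul_assoc, ← mul_assoc, mul_right_comm (_ + 2),
        moment_succ hα n, show ‖(n + 1 : ℂ)‖ = n + 1 by exact_mod_cast Complex.norm_natCast (n + 1)]
      ring
    simp only [hv]
    -- The constant 8 is `2 * 4`: `n + α + 3 ≤ 2 (n + α + 2)` because `α > -1`, and `n + α + 3 ≤ 4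
    -- (n + 1)` because `α ≤ 1`.
    refine summable_iff_of_le_of_le (c := 8) (C := 1) (fun n => ?_) (fun n => ?_)
      (fun n => ?_) fun n => ?_
    all_goals
      have hn : (0 : ℝ) ≤ n := n.cast_nonneg
      have hα2 : 0 ≤ n + α + 2 := by linarith
      push_cast
    · exact mul_nonneg (sq_nonneg _) (hX n)
    · exact mul_nonneg (by positivity) (hX n)
    · rw [← mul_assoc 8]
      refine mul_le_mul_of_nonneg_right ?_ (hX n)
      nlinarith
    · rw [one_mul]
      refine mul_le_mul_of_nonneg_right ?_ (hX n)
      nlinarith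

/-! ### Range inclusion and the Fredholm alternative in a Hilbert space. -/

section Abstract

variable {H : Type*} [NormedAddCommGroup H] [InnerProductSpace ℂ H] [CompleteSpace H]

/-- If the range of `E` is contained in that of an injective compact operator, `E` is compact. -/
theorem isCompactOperator_of_range_subset {D E : H →L[ℂ] H} (hD : IsCompactOperator D)
    (hinj : Function.Injective D) (h : ∀ f, ∃ g, D g = E f) : IsCompactOperator E := by
  choose s hs using h
  -- `S = D⁻¹E`, linear because `D` is injective. Its graph is closed: if `u → x` and `S u → y`,
  -- then `D y = lim E u = E x = D (S x)`.
  let S : H →ₗ[ℂ] H :=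
    { toFun := s
      map_add' := fun f g => hinj (by rw [map_add, hs, hs, hs, map_add])
      map_smul' := fun c f => hinj (by rw [map_smul, hs, hs, map_smul, RingHom.id_apply]) }
  have hcont : Continuous S := S.continuous_of_seq_closed_graph fun u x y hu hSu => by
    refine hinj (tendsto_nhds_unique ((D.continuous.tendsto y).comp hSu) ?_)
    have h1 := (E.continuous.tendsto x).comp hu
    change Tendsto _ _ (𝓝 (D (s x)))
    rw [hs]
    refine h1.congr fun n => ?_
    exact (hs (u n)).symm
  have := hD.comp_clm (⟨S, hcont⟩ : H →L[ℂ] H)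
  have e : (D ∘ (⟨S, hcont⟩ : H →L[ℂ] H)) = E := funext hs
  rwa [e] at this

/-- A compact perturbation of a coercive operator is onto as soon as it is one-to-one. -/
theorem surjective_add_compact {A K : H →L[ℂ] H} {c : ℝ} (hc : 0 < c)
    (hA : ∀ f, c * ‖f‖ ^ 2 ≤ (⟪f, A f⟫ : ℂ).re) (hK : IsCompactOperator K)
    (hinj : Function.Injective (A + K)) : Function.Surjective (A + K) := by
  -- Lax–Milgram.
  have hunit : IsUnit A := by
    refine ContinuousLinearMap.isUnit_of_forall_le_norm_inner_map A (c := ⟨c, hc.le⟩)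
      (by exact_mod_cast hc) fun f => ?_
    refine (by simpa [mul_comm] using hA f : ‖f‖ ^ 2 * c ≤ (⟪f, A f⟫ : ℂ).re).trans ?_
    rw [norm_inner_symm]
    exact Complex.re_le_norm _
  obtain ⟨U, rfl⟩ := hunit
  have hK' : IsCompactOperator ((↑U⁻¹ : H →L[ℂ] H) * K) := hK.clm_comp (↑U⁻¹ : H →L[ℂ] H)
  have e : (U : H →L[ℂ] H) + K = U * (1 + (↑U⁻¹ : H →L[ℂ] H) * K) := by
    rw [mul_add, mul_one, Units.mul_inv_cancel_left]
  -- An eigenvector of `U⁻¹K` for `-1` would lie in the kernel of `U + K = U(1 + U⁻¹K)`; by the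
  -- Fredholm alternative `-1` is then in the resolvent set.
  have hne : ¬ Module.End.HasEigenvalue
      (((↑U⁻¹ : H →L[ℂ] H) * K : H →L[ℂ] H) : Module.End ℂ H) (-1) := by
    intro hev
    obtain ⟨x, hx⟩ := hev.exists_hasEigenvector
    refine hx.2 (hinj ?_)
    have hx1 : ((↑U⁻¹ : H →L[ℂ] H) * K) x = (-1 : ℂ) • x := hx.apply_eq_smul
    rw [e, map_zero, mul_apply_eq_comp, add_apply, hx1]
    simp
  have hres := (hK'.hasEigenvalue_or_mem_resolventSet (neg_ne_zero.2 one_ne_zero)).resolve_left hne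
  rw [spectrum.mem_resolventSet_iff] at hres
  have hu2 : IsUnit (1 + (↑U⁻¹ : H →L[ℂ] H) * K) := by
    have := hres.neg
    convert this using 1
    rw [map_neg, map_one]
    abel
  have hu3 : IsUnit ((U : H →L[ℂ] H) + K) := by
    rw [e]
    exact U.isUnit.mul hu2
  obtain ⟨V, hV⟩ := hu3
  rw [← hV]
  intro y
  refine ⟨(↑V⁻¹ : H →L[ℂ] H) y, ?_⟩
  rw [← mul_apply_eq_comp, Units.mul_inv]
  rfl

end Abstract

theorem injective_shiftDefect (hα : -1 < α) : Function.Injective (shiftDefect α) := by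
  intro f g h
  refine ext_coeff fun n => ?_
  have h1 := coeff_shiftDefect hα f n
  rw [h, coeff_shiftDefect hα] at h1
  have hn : (0 : ℝ) ≤ n := n.cast_nonneg
  have hpos : 0 < (α + 1) / (n + α + 2) := div_pos (by linarith) (by linarith)
  exact (mul_left_cancel₀ (by exact_mod_cast hpos.ne') h1).symm

theorem isCompactOperator_of_rangeFunctions_subset (hα : -1 < α) {E : bergman α →L[ℂ] bergman α}
    (h : rangeFunctions E ⊆ genBergman (α - 2)) : IsCompactOperator E := by
  rw [← rangeFunctions_shiftDefect hα] at h
  refine isCompactOperator_of_range_subset (isCompactOperator_shiftDefect hα)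
    (injective_shiftDefect hα) fun f => ?_
  obtain ⟨-, g, hg⟩ := mem_rangeFunctions_iff.1 (h (mem_rangeFunctions_iff.2
    ⟨differentiableOn_analyticRep (E f), f, fun z _ => rfl⟩))
  exact ⟨g, ext_analyticRep hg⟩

/-! ### Commuting multiplications past the defect operator of the shift. -/

theorem taylorCoeff_id_mul_deriv_add {F : ℂ → ℂ} (hF : DifferentiableOn ℂ F (ball 0 1)) (c : ℂ)
    (n : ℕ) : taylorCoeff (fun z => z * deriv F z + c * F z) n = (n + c) * taylorCoeff F n := by
  rw [taylorCoeff_add (F := fun z => z * deriv F z)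
    (differentiableOn_id.mul (hF.deriv isOpen_ball)) (hF.const_mul c), taylorCoeff_id_mul_deriv hF, taylorCoeff_const_mul c hF, add_mul]

/-- The Euler operator `z d/dz + α + 2` multiplies the `n`-th coefficient by `n + α + 2`, cancelling
the denominator of the eigenvalue of `shiftDefect`. -/
theorem analyticRep_shiftDefect (hα : -1 < α) (f : bergman α) :
    EqOn (fun z => z * deriv (analyticRep (shiftDefect α f)) z +
      (α + 2 : ℝ) * analyticRep (shiftDefect α f) z) (fun z => (α + 1 : ℝ) * analyticRep f z)
      (ball 0 1) := by
  have hd := differentiableOn_analyticRep (shiftDefect α f)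
  refine eqOn_of_taylorCoeff_eq ((differentiableOn_id.mul (hd.deriv isOpen_ball)).add
    (hd.const_mul _)) ((differentiableOn_analyticRep f).const_mul _) fun n => ?_
  rw [taylorCoeff_const_mul _ (differentiableOn_analyticRep f)]
  refine (taylorCoeff_id_mul_deriv_add hd _ n).trans ?_
  have h1 := coeff_shiftDefect hα f n
  rw [coeff, coeff] at h1
  have hn : (0 : ℝ) ≤ n := n.cast_nonneg
  have hpos : (n + α + 2 : ℝ) ≠ 0 := by linarith
  rw [h1, ← mul_assoc, show (n : ℂ) = ((n : ℝ) : ℂ) by simp, ← Complex.ofReal_add,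
    ← Complex.ofReal_mul]
  congr 2
  field_simp
  ring

/-- The commutation relation between multiplication by `g` and the defect operator of the shift. -/
theorem multiplication_comp_shiftDefect (hα : -1 < α) {g : ℂ → ℂ}
    (hg : DifferentiableOn ℂ g (ball 0 1)) {M N : bergman α →L[ℂ] bergman α}
    (hM : IsMultiplication g M) (hN : IsMultiplication (fun z => z * deriv g z) N) :
    M.comp (shiftDefect α) =
      (shiftDefect α).comp (M + (((α + 1)⁻¹ : ℝ) : ℂ) • N.comp (shiftDefect α)) := by
  ext1 f
  have hα1 : α + 1 ≠ 0 := by linarith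
  refine ext_coeff fun n => ?_
  change coeff (M (shiftDefect α f)) n =
    coeff (shiftDefect α (M f + (((α + 1)⁻¹ : ℝ) : ℂ) • N (shiftDefect α f))) n
  have hd := differentiableOn_analyticRep (shiftDefect α f)
  -- With `L = z d/dz + α + 2` and `D` the defect of the shift, the product rule gives `L(g Df) = g
  -- L(Df) + z g' Df = (α + 1) g f + z g' Df`. Comparing coefficients then inverts `L`.
  have e : EqOn (fun z => z * deriv (fun z => g z * analyticRep (shiftDefect α f) z) z +
      (α + 2 : ℝ) * (g z * analyticRep (shiftDefect α f) z))
      (fun z => (α + 1 : ℝ) *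
        analyticRep (M f + (((α + 1)⁻¹ : ℝ) : ℂ) • N (shiftDefect α f)) z) (ball 0 1) := by
    intro z hz
    have h1 := analyticRep_shiftDefect hα f hz
    have hb := isOpen_ball.mem_nhds hz
    dsimp only at h1 ⊢
    rw [deriv_fun_mul (hg.differentiableAt hb) (hd.differentiableAt hb),
      analyticRep_add _ _ hz, analyticRep_smul _ _ hz, hM _ hz, hN _ hz]
    dsimp only
    have h2 : ((α + 1 : ℝ) : ℂ) * (((α + 1)⁻¹ : ℝ) : ℂ) = 1 := by
      rw [← Complex.ofReal_mul, mul_inv_cancel₀ hα1, Complex.ofReal_one]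
    linear_combination g z * h1 - z * deriv g z * analyticRep (shiftDefect α f) z * h2
  have e2 := taylorCoeff_id_mul_deriv_add (hg.mul hd) ((α + 2 : ℝ) : ℂ) n
  have e3 := congrFun (taylorCoeff_congr ((differentiableOn_analyticRep _).const_mul _) e) n
  have e4 := e3.symm.trans e2
  rw [taylorCoeff_const_mul _ (differentiableOn_analyticRep _)] at e4
  rw [coeff_eq (hg.mul hd) (hM _), coeff_shiftDefect hα, coeff]
  have hn : (0 : ℝ) ≤ n := n.cast_nonneg
  have hpos : (n + α + 2 : ℝ) ≠ 0 := by linarith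
  have hpos' : ((n + α + 2 : ℝ) : ℂ) ≠ 0 := by exact_mod_cast hpos
  rw [Complex.ofReal_div, div_mul_eq_mul_div, e4, eq_div_iff hpos']
  push_cast
  ring

/-! ### Factorization through a compact operator modulo compact perturbations. -/

section Abstract

variable {H : Type*} [NormedAddCommGroup H] [InnerProductSpace ℂ H]

open ContinuousLinearMap (adjoint)

/-- `E` factors through `D`, up to a compact operator, by an operator whose numerical range has
real part at least `c`. -/
def FactorsThrough (D : H →L[ℂ] H) (c : ℝ) (E : H →L[ℂ] H) : Prop :=
  ∃ A K : H →L[ℂ] H, IsCompactOperator K ∧ E = D * (A + K) ∧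
    ∀ f, c * ‖f‖ ^ 2 ≤ (⟪f, A f⟫ : ℂ).re

theorem FactorsThrough.add {D : H →L[ℂ] H} {c d : ℝ} {E F : H →L[ℂ] H}
    (hE : FactorsThrough D c E) (hF : FactorsThrough D d F) :
    FactorsThrough D (c + d) (E + F) := by
  obtain ⟨A, K, hK, rfl, hA⟩ := hE
  obtain ⟨B, L, hL, rfl, hB⟩ := hF
  refine ⟨A + B, K + L, hK.add hL, by noncomm_ring, fun f => ?_⟩
  rw [add_apply, inner_add_right, Complex.add_re, add_mul]
  exact add_le_add (hA f) (hB f)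

theorem inner_self_eq_ofReal (f : H) : (⟪f, f⟫ : ℂ) = ((‖f‖ ^ 2 : ℝ) : ℂ) := by
  refine (inner_self_eq_norm_sq_to_K (𝕜 := ℂ) f).trans ?_
  push_cast
  rfl

theorem factorsThrough_self (D : H →L[ℂ] H) : FactorsThrough D 1 D := by
  refine ⟨1, 0, isCompactOperator_zero, by simp, fun f => ?_⟩
  rw [one_apply_eq_self, inner_self_eq_ofReal, Complex.ofReal_re, one_mul]

theorem factorsThrough_zero (D : H →L[ℂ] H) : FactorsThrough D 0 0 :=
  ⟨0, 0, isCompactOperator_zero, by simp, fun f => by simp⟩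

theorem ext_of_inner_self {S T : H →L[ℂ] H} (h : ∀ f, (⟪f, S f⟫ : ℂ) = ⟪f, T f⟫) : S = T := by
  have := (ext_inner_map (S : H →ₗ[ℂ] H) T).1 fun x => by
    rw [← inner_conj_symm, ← inner_conj_symm (_ : H) x]
    exact congrArg conj (h x)
  ext x
  exact LinearMap.congr_fun this x

variable [CompleteSpace H]

theorem adjoint_id_sub_adjoint_comp_self (T : H →L[ℂ] H) :
    adjoint (ContinuousLinearMap.id ℂ H - (adjoint T).comp T) =
      ContinuousLinearMap.id ℂ H - (adjoint T).comp T := by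
  rw [map_sub, ContinuousLinearMap.adjoint_comp, ContinuousLinearMap.adjoint_adjoint,
    ContinuousLinearMap.adjoint_id]

/-- The adjoint of the commutation relation brings `D` to the left of `M^*`, so `M^* D(A + K)M` is
`D(M^*AM + compact)`. The form bound survives because `⟨f, M^*AMf⟩ = ⟨Mf, AMf⟩`. -/
theorem FactorsThrough.conj {D M N : H →L[ℂ] H} (hDc : IsCompactOperator D) (hD : adjoint D = D)
    {s : ℝ} (hMN : M.comp D = D.comp (M + (s : ℂ) • N.comp D)) {c d : ℝ} (hc : 0 ≤ c)
    {E : H →L[ℂ] H} (hE : FactorsThrough D c E) (hd : ∀ f, d * ‖f‖ ^ 2 ≤ ‖M f‖ ^ 2) :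
    FactorsThrough D (c * d) ((adjoint M).comp (E.comp M)) := by
  obtain ⟨A, K, hK, rfl, hA⟩ := hE
  have key : adjoint M * D = D * (adjoint M - (s : ℂ) • (adjoint N * D)) := by
    have h := congrArg adjoint hMN
    rw [ContinuousLinearMap.adjoint_comp, ContinuousLinearMap.adjoint_comp, map_add, hD,
      map_smulₛₗ, ContinuousLinearMap.adjoint_comp, hD, Complex.conj_ofReal] at h
    change D * adjoint M = (adjoint M + (s : ℂ) • (D * adjoint N)) * D at h
    rw [mul_sub, h, add_mul, smul_mul_assoc, mul_smul_comm, mul_assoc, add_sub_cancel_right]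
  refine ⟨adjoint M * A * M,
    adjoint M * K * M - (s : ℂ) • (adjoint N * (D * ((A + K) * M))), ?_, ?_, fun f => ?_⟩
  · refine IsCompactOperator.sub ((hK.clm_comp (adjoint M)).comp_clm M) (IsCompactOperator.smul ?_ _)
    exact (hDc.comp_clm ((A + K) * M)).clm_comp (adjoint N)
  · change adjoint M * (D * (A + K) * M) = _
    rw [mul_assoc D, ← mul_assoc, key]
    simp only [mul_add, mul_sub, add_mul, sub_mul, smul_mul_assoc, smul_add, mul_smul_comm,
      mul_assoc]
    abel
  · have e : (adjoint M * A * M) f = adjoint M (A (M f)) := rfl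
    rw [e, ContinuousLinearMap.adjoint_inner_right]
    refine le_trans ?_ (hA (M f))
    rw [mul_assoc]
    exact mul_le_mul_of_nonneg_left (hd f) hc

/-- Injectivity of `E = D(A + K)` passes to `A + K`, which is then onto. -/
theorem FactorsThrough.range_eq {D : H →L[ℂ] H} {c : ℝ} (hc : 0 < c) {E : H →L[ℂ] H}
    (hE : FactorsThrough D c E) (hinj : Function.Injective E) :
    (∀ f, ∃ g, D g = E f) ∧ ∀ g, ∃ f, E f = D g := by
  obtain ⟨A, K, hK, rfl, hA⟩ := hE
  refine ⟨fun f => ⟨(A + K) f, rfl⟩, fun g => ?_⟩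
  obtain ⟨f, hf⟩ := surjective_add_compact hc hA hK
    (fun x y h => hinj (congrArg D h : D ((A + K) x) = D ((A + K) y))) g
  exact ⟨f, congrArg D hf⟩

theorem id_sub_adjoint_comp_comp (S T : H →L[ℂ] H) :
    ContinuousLinearMap.id ℂ H - (adjoint (T.comp S)).comp (T.comp S) =
      (ContinuousLinearMap.id ℂ H - (adjoint S).comp S) +
      (adjoint S).comp ((ContinuousLinearMap.id ℂ H - (adjoint T).comp T).comp S) := by
  rw [ContinuousLinearMap.adjoint_comp]
  ext x
  simp

end Abstract

/-! ### Defect operators of products, and conjugation by multiplications. -/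

theorem toeplitz_congr {φ ψ : ℂ → ℂ} (hφ : φ ∈ unitBallHInfty) (hψ : ψ ∈ unitBallHInfty)
    (h : EqOn φ ψ (ball 0 1)) : toeplitz α φ hφ = toeplitz α ψ hψ :=
  (isMultiplication_toeplitz hφ).unique (isMultiplication_toeplitz hψ) h

theorem defectBar_mul {φ ψ χ : ℂ → ℂ} (hφ : φ ∈ unitBallHInfty) (hψ : ψ ∈ unitBallHInfty)
    (hχ : χ ∈ unitBallHInfty) (h : EqOn χ (fun z => φ z * ψ z) (ball 0 1)) :
    defectBar α χ hχ = defectBar α ψ hψ + (ContinuousLinearMap.adjoint (toeplitz α ψ hψ)).comp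
      ((defectBar α φ hφ).comp (toeplitz α ψ hψ)) := by
  have e : toeplitz α χ hχ = (toeplitz α φ hφ).comp (toeplitz α ψ hψ) :=
    (isMultiplication_toeplitz hχ).unique
      ((isMultiplication_toeplitz hφ).comp (isMultiplication_toeplitz hψ)) h
  rw [defectBar, e]
  exact id_sub_adjoint_comp_comp _ _

theorem FactorsThrough.conj_multiplication (hα : -1 < α) {c d : ℝ} (hc : 0 ≤ c)
    {E : bergman α →L[ℂ] bergman α} (hE : FactorsThrough (shiftDefect α) c E) {g : ℂ → ℂ}
    (hg : DifferentiableOn ℂ g (ball 0 1)) {M N : bergman α →L[ℂ] bergman α}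
    (hM : IsMultiplication g M) (hN : IsMultiplication (fun z => z * deriv g z) N)
    (hd : ∀ f, d * ‖f‖ ^ 2 ≤ ‖M f‖ ^ 2) :
    FactorsThrough (shiftDefect α) (c * d) ((ContinuousLinearMap.adjoint M).comp (E.comp M)) :=
  hE.conj (isCompactOperator_shiftDefect hα) (adjoint_id_sub_adjoint_comp_self _)
    (multiplication_comp_shiftDefect hα hg hM hN) hc hd

/-! ### Blaschke factors -/

/-- The Blaschke factor with zero `a`. -/
def blaschkeFactor (a z : ℂ) : ℂ := (z - a) / (1 - conj a * z)

theorem one_sub_conj_mul_ne_zero {a z : ℂ} (ha : ‖a‖ < 1) (hz : ‖z‖ ≤ 1) : 1 - conj a * z ≠ 0 := by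
  intro h
  have h1 : ‖conj a * z‖ < 1 := by
    rw [norm_mul, RCLike.norm_conj]
    nlinarith [norm_nonneg a, norm_nonneg z]
  rw [← sub_eq_zero.1 h, norm_one] at h1
  exact lt_irrefl _ h1

theorem one_sub_norm_blaschkeFactor_sq {a z : ℂ} (ha : ‖a‖ < 1) (hz : ‖z‖ ≤ 1) :
    1 - ‖blaschkeFactor a z‖ ^ 2 =
      (1 - ‖z‖ ^ 2) * ((1 - ‖a‖ ^ 2) / ‖1 - conj a * z‖ ^ 2) := by
  have h : ‖1 - conj a * z‖ ^ 2 ≠ 0 := by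
    have := one_sub_conj_mul_ne_zero ha hz
    positivity
  have e : ‖1 - conj a * z‖ ^ 2 - ‖z - a‖ ^ 2 = (1 - ‖z‖ ^ 2) * (1 - ‖a‖ ^ 2) := by
    simp only [← Complex.normSq_eq_norm_sq, Complex.normSq_apply, Complex.sub_re, Complex.sub_im,
      Complex.mul_re, Complex.mul_im, Complex.one_re, Complex.one_im, Complex.conj_re,
      Complex.conj_im]
    ring
  rw [blaschkeFactor, norm_div, div_pow, ← mul_div_assoc, eq_div_iff h, sub_mul, one_mul,
    div_mul_cancel₀ _ h, e]

theorem norm_blaschkeFactor_le {a z : ℂ} (ha : ‖a‖ < 1) (hz : ‖z‖ ≤ 1) : ‖blaschkeFactor a z‖ ≤ 1 := by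
  have h := one_sub_norm_blaschkeFactor_sq ha hz
  have h1 : 0 ≤ (1 - ‖z‖ ^ 2) * ((1 - ‖a‖ ^ 2) / ‖1 - conj a * z‖ ^ 2) := by
    refine mul_nonneg ?_ (div_nonneg ?_ (sq_nonneg _))
    · nlinarith [norm_nonneg z]
    · nlinarith [norm_nonneg a]
  nlinarith [norm_nonneg (blaschkeFactor a z)]

/-- A neighbourhood of the closed disk on which the Blaschke factor is analytic. -/
def blaschkeDomain (a : ℂ) : Set ℂ := {z | 1 - conj a * z ≠ 0}

theorem isOpen_blaschkeDomain (a : ℂ) : IsOpen (blaschkeDomain a) :=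
  isOpen_ne_fun (by fun_prop) continuous_const

theorem closedBall_subset_blaschkeDomain {a : ℂ} (ha : ‖a‖ < 1) :
    closedBall 0 1 ⊆ blaschkeDomain a := fun z hz =>
  one_sub_conj_mul_ne_zero ha (by simpa using hz)

theorem differentiableOn_blaschkeFactor (a : ℂ) :
    DifferentiableOn ℂ (blaschkeFactor a) (blaschkeDomain a) :=
  DifferentiableOn.div (by fun_prop) (by fun_prop) fun _ hz => hz

theorem blaschkeFactor_mem {a : ℂ} (ha : ‖a‖ < 1) : blaschkeFactor a ∈ unitBallHInfty :=
  ⟨(differentiableOn_blaschkeFactor a).mono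
    (ball_subset_closedBall.trans (closedBall_subset_blaschkeDomain ha)),
    fun _ hz => norm_blaschkeFactor_le ha (mem_ball_zero_iff.1 hz).le⟩

/-- Analyticity across the closed disk bounds both `g` and `z g'`, the two multipliers in the
commutation relation. -/
theorem exists_isMultiplication_of_isOpen {g : ℂ → ℂ} {U : Set ℂ} (hU : IsOpen U)
    (hg : DifferentiableOn ℂ g U) (hball : closedBall 0 1 ⊆ U) :
    (∃ M : bergman α →L[ℂ] bergman α, IsMultiplication g M) ∧
      ∃ N : bergman α →L[ℂ] bergman α, IsMultiplication (fun z => z * deriv g z) N := by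
  have hd : DifferentiableOn ℂ (fun z => z * deriv g z) U := differentiableOn_id.mul (hg.deriv hU)
  have key : ∀ h : ℂ → ℂ, DifferentiableOn ℂ h U →
      ∃ M : bergman α →L[ℂ] bergman α, IsMultiplication h M := by
    intro h hh
    obtain ⟨C, hC⟩ := (isCompact_closedBall (0 : ℂ) 1).exists_bound_of_continuousOn
      (hh.mono hball).continuousOn
    exact exists_isMultiplication (hh.mono (ball_subset_closedBall.trans hball))
      fun z hz => hC z (ball_subset_closedBall hz)
  exact ⟨key g hg, key _ hd⟩

/-- The quadratic forms agree since `1 - |b|² = (1 - |z|²) |g|²` for the Blaschke factor `b` and the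
multiplier `g` of `M`; complex polarization gives equality of the operators. -/
theorem defectBar_blaschkeFactor {a : ℂ} (ha : ‖a‖ < 1) {M : bergman α →L[ℂ] bergman α}
    (hM : IsMultiplication (fun z => (√(1 - ‖a‖ ^ 2) : ℂ) / (1 - conj a * z)) M) :
    defectBar α _ (blaschkeFactor_mem ha) =
      (ContinuousLinearMap.adjoint M).comp ((shiftDefect α).comp M) := by
  refine ext_of_inner_self fun f => ?_
  have e : ((ContinuousLinearMap.adjoint M).comp ((shiftDefect α).comp M)) f =
    ContinuousLinearMap.adjoint M (shiftDefect α (M f)) := rfl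
  rw [e, ContinuousLinearMap.adjoint_inner_right, shiftDefect, re_inner_defectBar,
    re_inner_defectBar]
  congr 1
  refine integral_congr_ae ?_
  filter_upwards [ae_mem_ball α] with z hz
  have hz1 : ‖z‖ ≤ 1 := (mem_ball_zero_iff.1 hz).le
  have ha1 : 0 ≤ 1 - ‖a‖ ^ 2 := by nlinarith [norm_nonneg a]
  rw [one_sub_norm_blaschkeFactor_sq ha hz1, hM f hz, norm_mul, mul_pow, norm_div, div_pow,
    Complex.norm_real, Real.norm_of_nonneg (Real.sqrt_nonneg _), Real.sq_sqrt ha1, mul_assoc]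

theorem factorsThrough_defectBar_blaschkeFactor (hα : -1 < α) {a : ℂ} (ha : ‖a‖ < 1) :
    ∃ d > 0, FactorsThrough (shiftDefect α) d (defectBar α _ (blaschkeFactor_mem ha)) := by
  set g : ℂ → ℂ := fun z => (√(1 - ‖a‖ ^ 2) : ℂ) / (1 - conj a * z) with hg
  have hgd : DifferentiableOn ℂ g (blaschkeDomain a) :=
    DifferentiableOn.div (by fun_prop) (by fun_prop) fun _ hz => hz
  have hsub := closedBall_subset_blaschkeDomain ha
  obtain ⟨⟨M, hM⟩, N, hN⟩ := exists_isMultiplication_of_isOpen (α := α)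
    (isOpen_blaschkeDomain a) hgd hsub
  have ha1 : 0 < 1 - ‖a‖ ^ 2 := by nlinarith [norm_nonneg a]
  -- The lower bound for `|g|²` that comes from `|1 - ā z| ≤ 2`.
  refine ⟨1 * ((1 - ‖a‖ ^ 2) / 4), by positivity, ?_⟩
  rw [defectBar_blaschkeFactor ha hM]
  refine (factorsThrough_self _).conj_multiplication hα zero_le_one
    (hgd.mono (ball_subset_closedBall.trans hsub)) hM hN fun f => ?_
  obtain ⟨hi, he⟩ := hM.norm_sq f
  rw [he, norm_sq_eq_integral, ← integral_const_mul]
  refine integral_mono_ae ((integrable_norm_sq f).const_mul _) hi ?_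
  filter_upwards [ae_mem_ball α] with z hz
  have hz1 : ‖z‖ ≤ 1 := (mem_ball_zero_iff.1 hz).le
  refine mul_le_mul_of_nonneg_right ?_ (sq_nonneg _)
  rw [hg, norm_div, div_pow, Complex.norm_real, Real.norm_of_nonneg (Real.sqrt_nonneg _),
    Real.sq_sqrt ha1.le]
  have h1 : ‖1 - conj a * z‖ ≤ 2 := by
    refine (norm_sub_le _ _).trans ?_
    rw [norm_one, norm_mul, RCLike.norm_conj]
    nlinarith [norm_nonneg a, norm_nonneg z]
  have h2 : 0 < ‖1 - conj a * z‖ := norm_pos_iff.2 (one_sub_conj_mul_ne_zero ha hz1)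
  exact div_le_div_of_nonneg_left ha1.le (by positivity) (by nlinarith)

theorem blaschkeProduct_mem {n : ℕ} {a : Fin n → ℂ} (ha : ∀ i, ‖a i‖ < 1) {c : ℂ} (hc : ‖c‖ = 1) :
    (fun z => c * ∏ i, blaschkeFactor (a i) z) ∈ unitBallHInfty := by
  refine ⟨(DifferentiableOn.fun_finsetProd fun i _ =>
    (blaschkeFactor_mem (ha i)).1).const_mul c, fun z hz => ?_⟩
  rw [norm_mul, hc, one_mul, norm_prod]
  exact Finset.prod_le_one (fun _ _ => norm_nonneg _) fun i _ => (blaschkeFactor_mem (ha i)).2 z hz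

theorem defectBar_congr {φ ψ : ℂ → ℂ} (hφ : φ ∈ unitBallHInfty) (hψ : ψ ∈ unitBallHInfty)
    (h : EqOn φ ψ (ball 0 1)) : defectBar α φ hφ = defectBar α ψ hψ := by
  rw [defectBar, defectBar, toeplitz_congr hφ hψ h]

/-- Induction peeling off the first factor `b`: the defect is that of `b` plus the conjugate by
`T_b` of the defect of the rest. The first term alone supplies a positive constant; the second only
needs a nonnegative one, hence `d := 0` below. The empty product has zero defect. -/
theorem factorsThrough_defectBar_blaschkeProduct (hα : -1 < α) (n : ℕ) (a : Fin n → ℂ)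
    (ha : ∀ i, ‖a i‖ < 1) {c : ℂ} (hc : ‖c‖ = 1) :
    ∃ d : ℝ, 0 ≤ d ∧ (n ≠ 0 → 0 < d) ∧
      FactorsThrough (shiftDefect α) d (defectBar α _ (blaschkeProduct_mem ha hc)) := by
  induction n with
  | zero =>
    refine ⟨0, le_rfl, fun h => absurd rfl h, ?_⟩
    have e : defectBar α _ (blaschkeProduct_mem ha hc) = 0 := by
      refine ext_of_inner_self fun f => ?_
      rw [re_inner_defectBar]
      simp [hc]
    rw [e]
    exact factorsThrough_zero _
  | succ n ih =>
    obtain ⟨d, hd, -, h⟩ := ih (fun i => a i.succ) fun i => ha i.succ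
    obtain ⟨d', hd', h'⟩ := factorsThrough_defectBar_blaschkeFactor hα (ha 0)
    refine ⟨d', hd'.le, fun _ => hd', ?_⟩
    rw [defectBar_mul (blaschkeProduct_mem (fun i => ha i.succ) hc) (blaschkeFactor_mem (ha 0))
      (blaschkeProduct_mem ha hc) fun z _ => by simp only [Fin.prod_univ_succ]; ring]
    obtain ⟨-, N, hN⟩ := exists_isMultiplication_of_isOpen (α := α)
      (isOpen_blaschkeDomain (a 0)) (differentiableOn_blaschkeFactor (a 0))
      (closedBall_subset_blaschkeDomain (ha 0))
    have h2 := h.conj_multiplication hα hd (blaschkeFactor_mem (ha 0)).1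
      (isMultiplication_toeplitz (blaschkeFactor_mem (ha 0))) hN (d := 0) fun f => by
        rw [zero_mul]; positivity
    have := h'.add h2
    rwa [mul_zero, add_zero] at this

/-! ### Injectivity of the defect operator -/

theorem norm_lt_one_of_not_constant {φ : ℂ → ℂ} (hφ : φ ∈ unitBallHInfty)
    (hne : ¬ ∃ c : ℂ, ‖c‖ = 1 ∧ ∀ z ∈ ball (0 : ℂ) 1, φ z = c) {z : ℂ} (hz : z ∈ ball (0 : ℂ) 1) :
    ‖φ z‖ < 1 := by
  refine lt_of_le_of_ne (hφ.2 z hz) fun h => hne ⟨φ z, h, ?_⟩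
  refine Complex.eqOn_of_isPreconnected_of_isMaxOn_norm (convex_ball _ _).isPreconnected
    isOpen_ball hφ.1 hz fun w hw => ?_
  simpa [h] using hφ.2 w hw

theorem integrable_defect {φ : ℂ → ℂ} (hφ : φ ∈ unitBallHInfty) (f : bergman α) :
    Integrable (fun z => (1 - ‖φ z‖ ^ 2) * ‖analyticRep f z‖ ^ 2) (weightedArea α) := by
  have h := (integrable_norm_sq f).sub ((isMultiplication_toeplitz (α := α) hφ).norm_sq f).1
  refine h.congr (Eventually.of_forall fun z => ?_)
  simp only [Pi.sub_apply]
  ring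

/-- By the maximum principle `1 - |φ|² > 0` on the disk, so the quadratic form vanishes only at
zero. -/
theorem injective_defectBar {φ : ℂ → ℂ} (hφ : φ ∈ unitBallHInfty)
    (hne : ¬ ∃ c : ℂ, ‖c‖ = 1 ∧ ∀ z ∈ ball (0 : ℂ) 1, φ z = c) :
    Function.Injective (defectBar α φ hφ) := by
  refine (injective_iff_map_eq_zero _).2 fun f hf => ?_
  have h := re_inner_defectBar hφ f
  have h0 : (⟪f, defectBar α φ hφ f⟫ : ℂ) = 0 := by
    rw [hf]
    exact inner_zero_right (𝕜 := ℂ) f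
  rw [h0] at h
  have h1 : ∫ z, (1 - ‖φ z‖ ^ 2) * ‖analyticRep f z‖ ^ 2 ∂weightedArea α = 0 := by
    exact_mod_cast h.symm
  have hpos : ∀ z ∈ ball (0 : ℂ) 1, 0 < 1 - ‖φ z‖ ^ 2 := fun z hz => by
    have := norm_lt_one_of_not_constant hφ hne hz
    nlinarith [norm_nonneg (φ z)]
  rw [integral_eq_zero_iff_of_nonneg_ae ((ae_mem_ball α).mono fun z hz =>
    mul_nonneg (hpos z hz).le (sq_nonneg _)) (integrable_defect hφ f)] at h1
  refine Subtype.ext (Lp.ext ?_)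
  filter_upwards [h1, ae_mem_ball α, ae_eq_analyticRep f,
    Lp.coeFn_zero ℂ 2 (weightedArea α)] with z hz hzb h2 h3
  have h4 := (mul_eq_zero.1 hz).resolve_left (hpos z hzb).ne'
  rw [h2, norm_eq_zero.1 (pow_eq_zero_iff two_ne_zero |>.1 h4)]
  exact h3.symm

theorem rangeFunctions_defectBar_of_isFiniteBlaschkeProduct (hα : -1 < α) {φ : ℂ → ℂ}
    (hφ : φ ∈ unitBallHInfty) (hne : ¬ ∃ c : ℂ, ‖c‖ = 1 ∧ ∀ z ∈ ball (0 : ℂ) 1, φ z = c)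
    (hB : IsFiniteBlaschkeProduct φ) :
    rangeFunctions (defectBar α φ hφ) = genBergman (α - 2) := by
  obtain ⟨n, a, c, hc, ha, hz⟩ := hB
  have hn : n ≠ 0 := by
    rintro rfl
    exact hne ⟨c, hc, fun z hz' => by simpa using hz z hz'⟩
  obtain ⟨d, -, hd, h⟩ := factorsThrough_defectBar_blaschkeProduct (α := α) hα n a ha hc
  rw [← defectBar_congr hφ (blaschkeProduct_mem ha hc) hz] at h
  obtain ⟨h1, h2⟩ := h.range_eq (hd hn) (injective_defectBar hφ hne)
  rw [← rangeFunctions_shiftDefect hα]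
  ext F
  rw [mem_rangeFunctions_iff, mem_rangeFunctions_iff]
  refine and_congr_right fun _ => ⟨?_, ?_⟩
  · rintro ⟨f, hf⟩
    obtain ⟨g, hg⟩ := h1 f
    exact ⟨g, by rwa [hg]⟩
  · rintro ⟨g, hg⟩
    obtain ⟨f, hf⟩ := h2 g
    exact ⟨f, by rwa [hf]⟩

/-! ### The reproducing kernel -/

theorem exists_norm_analyticRep_le (α : ℝ) {z : ℂ} (hz : z ∈ ball (0 : ℂ) 1) :
    ∃ C : ℝ, ∀ f : bergman α, ‖analyticRep f z‖ ≤ C * ‖f‖ := by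
  obtain ⟨C, hC, h⟩ := exists_pointwise_bound_at α hz
  refine ⟨√C.toReal, fun f => ?_⟩
  have h1 := h _ (differentiableOn_analyticRep f)
  rw [← eLpNorm_congr_ae (ae_eq_analyticRep f)] at h1
  have h2 := ENNReal.toReal_mono (ENNReal.mul_ne_top hC
    (ENNReal.pow_ne_top (Lp.eLpNorm_ne_top (f : Lp ℂ 2 (weightedArea α))))) h1
  rw [ENNReal.toReal_mul, ENNReal.toReal_pow, ENNReal.toReal_pow, ← Lp.norm_def, toReal_enorm] at h2
  refine (abs_le_of_sq_le_sq' ?_ (by positivity)).2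
  rw [mul_pow, Real.sq_sqrt ENNReal.toReal_nonneg]
  exact h2

/-- Evaluation at a point of the disk, as a continuous linear functional (zero elsewhere). -/
def evaluation (α : ℝ) (z : ℂ) : bergman α →L[ℂ] ℂ :=
  open Classical in
  if hz : z ∈ ball (0 : ℂ) 1 then
    LinearMap.mkContinuous
      { toFun := fun f => analyticRep f z
        map_add' := fun f g => analyticRep_add f g hz
        map_smul' := fun c f => analyticRep_smul c f hz }
      (exists_norm_analyticRep_le α hz).choose (exists_norm_analyticRep_le α hz).choose_spec
  else 0

theorem evaluation_apply {z : ℂ} (hz : z ∈ ball (0 : ℂ) 1) (f : bergman α) :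
    evaluation α z f = analyticRep f z := by
  rw [evaluation, dif_pos hz]
  rfl

/-- The reproducing kernel at `z`. -/
def kernel (α : ℝ) (z : ℂ) : bergman α := (InnerProductSpace.toDual ℂ _).symm (evaluation α z)

theorem inner_kernel {z : ℂ} (hz : z ∈ ball (0 : ℂ) 1) (f : bergman α) :
    ⟪kernel α z, f⟫ = analyticRep f z := by
  rw [kernel, InnerProductSpace.toDual_symm_apply, evaluation_apply hz]

theorem coeff_kernel (hα : -1 < α) {z : ℂ} (hz : z ∈ ball (0 : ℂ) 1) (n : ℕ) :
    coeff (kernel α z) n = conj z ^ n / moment α n := by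
  have hm : (moment α n : ℂ) ≠ 0 := by exact_mod_cast (moment_pos hα n).ne'
  have h := inner_monomial hα n (kernel α z)
  have h2 : (⟪monomial hα n, kernel α z⟫ : ℂ) = conj (⟪kernel α z, monomial hα n⟫ : ℂ) :=
    (inner_conj_symm (𝕜 := ℂ) _ _).symm
  rw [h2, inner_kernel hz, analyticRep_monomial hα n hz, map_pow] at h
  rw [eq_div_iff hm, h, mul_comm]

/-- Up to a constant, the reciprocal moments are the binomial coefficients of `(1 - x)^(-(α+2))`, so
the series for the kernel norm has a closed form. -/
theorem multichoose_mul_moment (hα : -1 < α) (n : ℕ) :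
    Ring.multichoose (α + 2) n * moment α n = moment α 0 := by
  induction n with
  | zero => rw [Ring.multichoose_zero_right, one_mul]
  | succ n ih =>
    have h1 := Ring.factorial_nsmul_multichoose_eq_ascPochhammer (α + 2) n
    have h2 := Ring.factorial_nsmul_multichoose_eq_ascPochhammer (α + 2) (n + 1)
    rw [ascPochhammer_succ_right, Polynomial.smeval_mul, ← h1, Polynomial.smeval_add,
      Polynomial.smeval_X, ← Polynomial.C_eq_natCast, Polynomial.smeval_C] at h2
    simp only [nsmul_eq_mul, Nat.factorial_succ, pow_one, pow_zero, mul_one, Nat.cast_mul,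
      Nat.cast_succ] at h2
    have hf : (n.factorial : ℝ) ≠ 0 := by exact_mod_cast n.factorial_ne_zero
    have h3 : (n + 1) * Ring.multichoose (α + 2) (n + 1) =
        Ring.multichoose (α + 2) n * (α + 2 + n) := by
      refine mul_left_cancel₀ hf ?_
      linear_combination h2
    have h4 := moment_succ hα n
    have hn : (n + 1 : ℝ) ≠ 0 := by positivity
    refine mul_left_cancel₀ hn ?_
    rw [← mul_assoc, h3, ← ih]
    linear_combination Ring.multichoose (α + 2) n * h4

theorem norm_kernel_sq (hα : -1 < α) {z : ℂ} (hz : z ∈ ball (0 : ℂ) 1) :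
    ‖kernel α z‖ ^ 2 = (moment α 0 * (1 - ‖z‖ ^ 2) ^ (α + 2))⁻¹ := by
  have h1 : ‖z‖ < 1 := by simpa using hz
  have h2 : ‖z‖ ^ 2 < 1 := by nlinarith [norm_nonneg z]
  have hs := (Real.one_div_one_sub_rpow_hasFPowerSeriesOnBall_zero (α + 2)).hasSum
    (y := ‖z‖ ^ 2) (by
      rw [← ENNReal.ofReal_one, Metric.eball_ofReal, mem_ball_zero_iff]
      simpa using h2)
  simp only [FormalMultilinearSeries.ofScalars_apply_eq, zero_add, smul_eq_mul,
    ← Ring.multichoose_eq] at hs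
  have hk := hasSum_norm_sq hα (kernel α z)
  refine hk.unique ?_
  rw [mul_inv, ← one_div ((1 - ‖z‖ ^ 2) ^ (α + 2))]
  refine (hs.mul_left (moment α 0)⁻¹).congr_fun fun n => ?_
  have hm := moment_pos hα n
  have hm0 := moment_pos hα 0
  have h3 : Ring.multichoose (α + 2) n = moment α 0 / moment α n := by
    rw [eq_div_iff hm.ne', multichoose_mul_moment hα]
  rw [coeff_kernel hα hz, h3, norm_div, norm_pow, RCLike.norm_conj, Complex.norm_real,
    Real.norm_of_nonneg hm.le]
  field_simp
  rw [← pow_mul, ← pow_mul, mul_comm]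

theorem norm_kernel_pos (hα : -1 < α) {z : ℂ} (hz : z ∈ ball (0 : ℂ) 1) : 0 < ‖kernel α z‖ := by
  have h1 : ‖z‖ < 1 := by simpa using hz
  have h2 : 0 < 1 - ‖z‖ ^ 2 := by nlinarith [norm_nonneg z]
  have hm0 := moment_pos hα 0
  have h3 : 0 < ‖kernel α z‖ ^ 2 := by
    rw [norm_kernel_sq hα hz]
    positivity
  exact lt_of_pow_lt_pow_left₀ 2 (norm_nonneg _) (by rwa [zero_pow two_ne_zero])

theorem exists_lt_norm_kernel (hα : -1 < α) (B : ℝ) :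
    ∃ r < 1, ∀ z ∈ ball (0 : ℂ) 1, r < ‖z‖ → B < ‖kernel α z‖ := by
  have hp : 0 < α + 2 := by linarith
  have hm0 := moment_pos hα 0
  have hc : Tendsto (fun t : ℝ => moment α 0 * (1 - t ^ 2) ^ (α + 2)) (𝓝 1) (𝓝 0) := by
    have h := (continuous_const.mul (continuous_one_sub_sq_rpow hp)).tendsto
      (f := fun t : ℝ => moment α 0 * (1 - t ^ 2) ^ (α + 2)) 1
    simpa [Real.zero_rpow hp.ne'] using h
  have hev := hc.eventually (gt_mem_nhds (show (0 : ℝ) < (B ^ 2 + 1)⁻¹ by positivity))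
  obtain ⟨r, hr, hrs⟩ := exists_Ioc_subset_of_mem_nhds hev ⟨0, one_pos⟩
  refine ⟨r, hr, fun z hz hrz => ?_⟩
  have h1 : ‖z‖ < 1 := by simpa using hz
  have h2 : 0 < 1 - ‖z‖ ^ 2 := by nlinarith [norm_nonneg z]
  have h3 : moment α 0 * (1 - ‖z‖ ^ 2) ^ (α + 2) < (B ^ 2 + 1)⁻¹ := hrs ⟨hrz, h1.le⟩
  have h4 : B ^ 2 + 1 < ‖kernel α z‖ ^ 2 := by
    rw [norm_kernel_sq hα hz]
    exact (lt_inv_comm₀ (by positivity) (by positivity)).1 h3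
  exact lt_of_pow_lt_pow_left₀ 2 (norm_nonneg _) (by linarith)

theorem exists_norm_analyticRep_le_of_mem_span (hα : -1 < α) {f : bergman α}
    (hf : f ∈ Submodule.span ℂ (range (monomialBasis hα))) :
    ∃ C : ℝ, ∀ z ∈ ball (0 : ℂ) 1, ‖analyticRep f z‖ ≤ C := by
  induction hf using Submodule.span_induction with
  | mem f hf =>
    obtain ⟨n, rfl⟩ := hf
    refine ⟨‖(((√(moment α n))⁻¹ : ℝ) : ℂ)‖, fun z hz => ?_⟩
    have h1 : ‖z‖ < 1 := by simpa using hz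
    rw [monomialBasis_apply, unitMonomial, analyticRep_smul _ _ hz, analyticRep_monomial hα n hz,
      norm_mul, norm_pow]
    exact mul_le_of_le_one_right (norm_nonneg _) (pow_le_one₀ (norm_nonneg _) h1.le)
  | zero =>
    refine ⟨0, fun z hz => ?_⟩
    have := analyticRep_smul (0 : ℂ) (0 : bergman α) hz
    rw [zero_smul, zero_mul] at this
    simp [this]
  | add f g _ _ hf hg =>
    obtain ⟨C, hC⟩ := hf
    obtain ⟨D, hD⟩ := hg
    refine ⟨C + D, fun z hz => ?_⟩
    rw [analyticRep_add _ _ hz]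
    exact (norm_add_le _ _).trans (add_le_add (hC z hz) (hD z hz))
  | smul c f _ hf =>
    obtain ⟨C, hC⟩ := hf
    refine ⟨‖c‖ * C, fun z hz => ?_⟩
    rw [analyticRep_smul _ _ hz, norm_mul]
    exact mul_le_mul_of_nonneg_left (hC z hz) (norm_nonneg _)

theorem norm_analyticRep_le {z : ℂ} (hz : z ∈ ball (0 : ℂ) 1) (f : bergman α) :
    ‖analyticRep f z‖ ≤ ‖kernel α z‖ * ‖f‖ := by
  rw [← inner_kernel hz]
  exact norm_inner_le_norm (𝕜 := ℂ) _ _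

/-- The normalized kernels tend weakly to zero at the boundary. -/
theorem exists_norm_analyticRep_le_mul_norm_kernel (hα : -1 < α) (f : bergman α) {ε : ℝ}
    (hε : 0 < ε) :
    ∃ r < 1, ∀ z ∈ ball (0 : ℂ) 1, r < ‖z‖ → ‖analyticRep f z‖ ≤ ε * ‖kernel α z‖ := by
  have hf : f ∈ closure (Submodule.span ℂ (range (monomialBasis hα)) : Set (bergman α)) := by
    rw [← Submodule.topologicalClosure_coe, (monomialBasis hα).dense_span]
    trivial
  -- A polynomial `p` within `ε/2` of `f`: the error at `z` is at most `ε/2 * ‖k_z‖`, while `p` is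
  -- bounded and `‖k_z‖` tends to infinity.
  obtain ⟨p, hp, hfp⟩ := Metric.mem_closure_iff.1 hf (ε / 2) (half_pos hε)
  obtain ⟨C, hC⟩ := exists_norm_analyticRep_le_of_mem_span hα hp
  obtain ⟨r, hr, h⟩ := exists_lt_norm_kernel hα (C / (ε / 2))
  refine ⟨r, hr, fun z hz hrz => ?_⟩
  have h1 := h z hz hrz
  rw [div_lt_iff₀ (half_pos hε)] at h1
  have h2 := norm_analyticRep_le hz (f - p)
  rw [analyticRep_sub _ _ hz] at h2
  have h3 : ‖f - p‖ ≤ ε / 2 := by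
    rw [dist_eq_norm] at hfp
    exact hfp.le
  have h4 : ‖analyticRep f z‖ ≤ ‖analyticRep f z - analyticRep p z‖ + ‖analyticRep p z‖ := by
    simpa using norm_add_le (analyticRep f z - analyticRep p z) (analyticRep p z)
  have h5 := hC z hz
  have h6 : ‖kernel α z‖ * ‖f - p‖ ≤ ‖kernel α z‖ * (ε / 2) :=
    mul_le_mul_of_nonneg_left h3 (norm_nonneg _)
  linarith

/-- The inner product is the value of `E k_z` at `z`. The image of the unit ball has a finite
`ε/2`-net, and near the circle the values of all its members at `z` are small relative to `‖k_z‖`,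
with one common radius. -/
theorem exists_norm_inner_kernel_le_of_isCompactOperator (hα : -1 < α)
    {E : bergman α →L[ℂ] bergman α} (hE : IsCompactOperator E) {ε : ℝ} (hε : 0 < ε) :
    ∃ r < 1, ∀ z ∈ ball (0 : ℂ) 1, r < ‖z‖ →
      ‖(⟪kernel α z, E (kernel α z)⟫ : ℂ)‖ ≤ ε * ‖kernel α z‖ ^ 2 := by
  have hcomp := hE.isCompact_closure_image_closedBall (f := (E : bergman α →ₗ[ℂ] bergman α)) 1
  have htb := hcomp.totallyBounded.subset subset_closure
  obtain ⟨t, ht, hcov⟩ := Metric.totallyBounded_iff.1 htb (ε / 2) (half_pos hε)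
  have hr : ∃ r < 1, ∀ y ∈ t, ∀ z ∈ ball (0 : ℂ) 1, r < ‖z‖ →
      ‖analyticRep y z‖ ≤ ε / 2 * ‖kernel α z‖ := by
    clear hcov
    induction t, ht using Set.Finite.induction_on with
    | empty => exact ⟨0, one_pos, by simp⟩
    | insert _ _ ih =>
      obtain ⟨r, hr, h⟩ := ih
      rename_i y _ _ _
      obtain ⟨r', hr', h'⟩ := exists_norm_analyticRep_le_mul_norm_kernel hα y (half_pos hε)
      refine ⟨max r r', max_lt hr hr', ?_⟩
      rintro x (rfl | hx) z hz hrz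
      · exact h' z hz ((le_max_right _ _).trans_lt hrz)
      · exact h x hx z hz ((le_max_left _ _).trans_lt hrz)
  obtain ⟨r, hr1, h⟩ := hr
  refine ⟨r, hr1, fun z hz hrz => ?_⟩
  set k := kernel α z with hk
  have hpos : 0 < ‖k‖ := norm_kernel_pos hα hz
  have hmem : E (((‖k‖⁻¹ : ℝ) : ℂ) • k) ∈ (E : bergman α →ₗ[ℂ] bergman α) '' closedBall 0 1 := by
    refine ⟨_, ?_, rfl⟩
    rw [mem_closedBall_zero_iff]
    refine (norm_smul_le _ _).trans ?_
    rw [Complex.norm_real, Real.norm_of_nonneg (by positivity)]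
    exact (inv_mul_cancel₀ hpos.ne').le
  obtain ⟨y, hy, hdist⟩ := mem_iUnion₂.1 (hcov hmem)
  rw [mem_ball, dist_eq_norm] at hdist
  have h1 : analyticRep (E (((‖k‖⁻¹ : ℝ) : ℂ) • k)) z = ((‖k‖⁻¹ : ℝ) : ℂ) * analyticRep (E k) z := by
    rw [map_smul]
    exact analyticRep_smul _ _ hz
  have h2 := norm_analyticRep_le hz (E (((‖k‖⁻¹ : ℝ) : ℂ) • k) - y)
  rw [analyticRep_sub _ _ hz, h1, ← hk] at h2
  have h3 := h y hy z hz hrz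
  rw [← hk] at h3
  have h4 : ‖((‖k‖⁻¹ : ℝ) : ℂ) * analyticRep (E k) z‖ ≤
      ‖((‖k‖⁻¹ : ℝ) : ℂ) * analyticRep (E k) z - analyticRep y z‖ + ‖analyticRep y z‖ := by
    simpa using norm_add_le (((‖k‖⁻¹ : ℝ) : ℂ) * analyticRep (E k) z - analyticRep y z)
      (analyticRep y z)
  have h5 := mul_le_mul_of_nonneg_left hdist.le hpos.le
  rw [norm_mul, Complex.norm_real, Real.norm_of_nonneg (by positivity)] at h4
  have h6 : ‖k‖⁻¹ * ‖analyticRep (E k) z‖ ≤ ε * ‖k‖ := by linarith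
  rw [hk, inner_kernel hz, ← hk]
  rw [inv_mul_le_iff₀ hpos] at h6
  linarith

/-! ### Local lower bounds for the defect form -/

/-- Made for `t = 1 - |z|` and `s = 1 - |w|²` with `|w - z| < t/2`. The two constants in the minimum
serve the two signs of the exponent. -/
theorem exists_rpow_lower_bound (α : ℝ) :
    ∃ κ : ℝ, 0 < κ ∧ ∀ t s : ℝ, 0 < t → t / 2 ≤ s → s ≤ 3 * t → κ * t ^ α ≤ s ^ α := by
  refine ⟨min ((1 / 2) ^ α) (3 ^ α), lt_min (by positivity) (by positivity), ?_⟩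
  intro t s ht h1 h2
  have hta : 0 ≤ t ^ α := (Real.rpow_pos_of_pos ht α).le
  rcases le_total 0 α with h | h
  · calc min ((1 / 2) ^ α) (3 ^ α) * t ^ α ≤ (1 / 2) ^ α * t ^ α :=
          mul_le_mul_of_nonneg_right (min_le_left _ _) hta
      _ = (t / 2) ^ α := by
          rw [← Real.mul_rpow (by norm_num) ht.le]
          congr 1
          ring
      _ ≤ s ^ α := Real.rpow_le_rpow (by positivity) h1 h
  · calc min ((1 / 2) ^ α) (3 ^ α) * t ^ α ≤ 3 ^ α * t ^ α :=
          mul_le_mul_of_nonneg_right (min_le_right _ _) hta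
      _ = (3 * t) ^ α := by rw [← Real.mul_rpow (by norm_num) ht.le]
      _ ≤ s ^ α := Real.rpow_le_rpow_of_nonpos (by linarith) h2 h

theorem ball_subset_unitBall {z : ℂ} {η : ℝ} (hη : η ≤ 1) (hz : ‖z‖ < 1) :
    ball z (η * (1 - ‖z‖)) ⊆ ball 0 1 := by
  refine ball_subset_ball' ?_
  rw [dist_zero_right]
  nlinarith

/-- Sub-mean value property on disks of radius comparable to the distance to the boundary. -/
theorem exists_local_lower_bound (hα : -1 < α) {η : ℝ} (hη : 0 < η) (hη2 : η ≤ 1 / 2) :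
    ∃ c : ℝ, 0 < c ∧ ∀ z ∈ ball (0 : ℂ) 1, ∀ f : bergman α,
      c * (1 - ‖z‖) ^ (α + 2) * ‖analyticRep f z‖ ^ 2 ≤
        ∫ w in ball z (η * (1 - ‖z‖)), ‖analyticRep f w‖ ^ 2 ∂weightedArea α := by
  obtain ⟨κ, hκ, hκle⟩ := exists_rpow_lower_bound α
  have hα1 : 0 < α + 1 := by linarith
  have hpi := Real.pi_pos
  -- The first two factors bound the density from below by a multiple of `(1 - |z|)^α`; `(η/2)²` is
  -- the constant of `areaMean`, whose squared radius supplies the remaining `(1 - |z|)²`.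
  refine ⟨(α + 1) / Real.pi * κ * (η / 2) ^ 2, by positivity, fun z hz f => ?_⟩
  have hz1 : ‖z‖ < 1 := by simpa using hz
  set t := 1 - ‖z‖ with ht
  have ht0 : 0 < t := by linarith
  set F := analyticRep f with hF
  have hFd := differentiableOn_analyticRep f
  have hsub := ball_subset_unitBall (by linarith : η ≤ 1) hz1
  rw [← ht] at hsub
  set m : ℝ := (α + 1) / Real.pi * κ * t ^ α with hm
  have hm0 : 0 < m := by positivity
  have hdens : ∀ w ∈ ball z (η * t), m ≤ areaDensity α w := by
    intro w hw
    have hw1 : ‖w - z‖ < t / 2 := by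
      have := mem_ball_iff_norm.1 hw
      nlinarith
    have h1 : ‖w‖ ≤ ‖z‖ + ‖w - z‖ := by simpa using norm_add_le z (w - z)
    have h2 : ‖z‖ ≤ ‖w‖ + ‖w - z‖ := by
      rw [norm_sub_rev]
      simpa using norm_add_le w (z - w)
    have hw0 := norm_nonneg w
    have hz0 := norm_nonneg z
    rw [areaDensity, if_pos hα, hm, mul_assoc ((α + 1) / Real.pi)]
    refine mul_le_mul_of_nonneg_left (hκle t _ ht0 ?_ ?_) (by positivity)
    · nlinarith
    · nlinarith
  have h1 := areaMean (F := fun w => F w ^ 2) (by positivity : 0 < η * t) ((hFd.mono hsub).pow 2)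
  have h2 : ENNReal.ofReal m * ∫⁻ w in ball z (η * t), ‖F w ^ 2‖ₑ ≤
      ∫⁻ w in ball z (η * t), ‖‖F w‖ ^ 2‖ₑ ∂weightedArea α := by
    rw [weightedArea, restrict_withDensity measurableSet_ball,
      lintegral_withDensity_eq_lintegral_mul_non_measurable _
        (measurable_areaDensity α).ennreal_ofReal (by simp),
      Measure.restrict_restrict measurableSet_ball, inter_eq_left.2 hsub,
      ← lintegral_const_mul' _ _ (by simp)]
    refine setLIntegral_mono' measurableSet_ball fun w hw => ?_
    simp only [Pi.mul_apply, enorm_pow, enorm_norm]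
    gcongr
    exact hdens w hw
  have hint : IntegrableOn (fun w => ‖F w‖ ^ 2) (ball z (η * t)) (weightedArea α) :=
    (integrable_norm_sq f).integrableOn
  have h3 : ∫⁻ w in ball z (η * t), ‖‖F w‖ ^ 2‖ₑ ∂weightedArea α =
      ENNReal.ofReal (∫ w in ball z (η * t), ‖F w‖ ^ 2 ∂weightedArea α) := by
    rw [ofReal_integral_eq_lintegral_ofReal hint (Eventually.of_forall fun _ => sq_nonneg _)]
    refine lintegral_congr fun w => ?_
    rw [Real.enorm_of_nonneg (sq_nonneg _)]
  rw [h3] at h2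
  have h4 : ENNReal.ofReal (m * (‖F z‖ ^ 2 * (η * t / 2) ^ 2)) ≤
      ENNReal.ofReal (∫ w in ball z (η * t), ‖F w‖ ^ 2 ∂weightedArea α) := by
    refine le_trans ?_ h2
    rw [ENNReal.ofReal_mul hm0.le, ENNReal.ofReal_mul (sq_nonneg _),
      ENNReal.ofReal_pow (by positivity : 0 ≤ η * t / 2) 2]
    refine mul_le_mul_right (le_trans (le_of_eq ?_) h1) _
    rw [ENNReal.ofReal_pow (norm_nonneg _), ofReal_norm, enorm_pow]
  have h5 := (ENNReal.ofReal_le_ofReal_iff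
    (setIntegral_nonneg measurableSet_ball fun _ _ => sq_nonneg _)).1 h4
  refine le_trans (le_of_eq ?_) h5
  rw [hm, Real.rpow_add ht0, Real.rpow_two]
  ring

/-- Schwarz's lemma: `φ` maps the disk of radius `1 - |z|` about `z` into one of radius 2 about `φ
z`, so on a `δ/4` fraction of that radius it moves by at most `δ/2`. -/
theorem le_one_sub_norm_sq_of_mem_ball {φ : ℂ → ℂ} (hφ : φ ∈ unitBallHInfty) {δ : ℝ} (hδ : 0 < δ)
    (hδ1 : δ ≤ 1) {z : ℂ} (hz : z ∈ ball (0 : ℂ) 1) (hφz : ‖φ z‖ ≤ 1 - δ) {w : ℂ}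
    (hw : w ∈ ball z (δ / 4 * (1 - ‖z‖))) : δ / 2 ≤ 1 - ‖φ w‖ ^ 2 := by
  have hz1 : ‖z‖ < 1 := by simpa using hz
  have ht0 : 0 < 1 - ‖z‖ := by linarith
  have hsub : ball z (1 - ‖z‖) ⊆ ball 0 1 := by
    simpa using ball_subset_unitBall (le_refl (1 : ℝ)) hz1
  have hmaps : MapsTo φ (ball z (1 - ‖z‖)) (closedBall (φ z) 2) := fun u hu => by
    rw [mem_closedBall_iff_norm]
    linarith [norm_sub_le (φ u) (φ z), hφ.2 u (hsub hu), hφ.2 z hz]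
  have hw' : w ∈ ball z (1 - ‖z‖) := ball_subset_ball (by nlinarith) hw
  have h1 := Complex.dist_le_div_mul_dist_of_mapsTo_ball (hφ.1.mono hsub) hmaps hw'
  rw [mem_ball] at hw
  have h2 : 2 / (1 - ‖z‖) * dist w z ≤ δ / 2 := by
    rw [div_mul_eq_mul_div, div_le_iff₀ ht0]
    linarith
  rw [dist_eq_norm] at h1
  have h3 : ‖φ w‖ ≤ ‖φ z‖ + ‖φ w - φ z‖ := by simpa using norm_add_le (φ z) (φ w - φ z)
  have h4 := norm_nonneg (φ w)
  nlinarith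

/-- Only the part of `∫ (1 - |φ|²) |k_z|²` over a small disk about `z` is kept. There the first
factor is at least `δ/2`, and the sub-mean value property with `k_z(z) = ‖k_z‖²` handles the second.
-/
theorem exists_le_norm_inner_defectBar_kernel (hα : -1 < α) {φ : ℂ → ℂ} (hφ : φ ∈ unitBallHInfty)
    {δ : ℝ} (hδ : 0 < δ) (hδ1 : δ ≤ 1) :
    ∃ c : ℝ, 0 < c ∧ ∀ z ∈ ball (0 : ℂ) 1, ‖φ z‖ ≤ 1 - δ →
      c * ‖kernel α z‖ ^ 2 ≤ ‖(⟪kernel α z, defectBar α φ hφ (kernel α z)⟫ : ℂ)‖ := by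
  obtain ⟨c, hc, h⟩ := exists_local_lower_bound hα (by positivity : 0 < δ / 4) (by linarith)
  have hm0 := moment_pos hα 0
  refine ⟨δ / 2 * (c * ((1 / 2) ^ (α + 2) * (moment α 0)⁻¹)), by positivity, fun z hz hφz => ?_⟩
  have hz1 : ‖z‖ < 1 := by simpa using hz
  have hz0 := norm_nonneg z
  set k := kernel α z with hk
  have hnn : 0 ≤ᵐ[weightedArea α] fun w => (1 - ‖φ w‖ ^ 2) * ‖analyticRep k w‖ ^ 2 := by
    filter_upwards [ae_mem_ball α] with w hw
    have := hφ.2 w hw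
    exact mul_nonneg (by nlinarith [norm_nonneg (φ w)]) (sq_nonneg _)
  have hI := integrable_defect hφ k
  rw [re_inner_defectBar, Complex.norm_real, Real.norm_of_nonneg (integral_nonneg_of_ae hnn)]
  have hkz : ‖analyticRep k z‖ = ‖k‖ ^ 2 := by
    rw [← inner_kernel hz, ← hk, inner_self_eq_ofReal, Complex.norm_real,
      Real.norm_of_nonneg (sq_nonneg _)]
  -- From the closed form of the kernel norm and `1 - |z|² ≤ 2 (1 - |z|)`.
  have hb : (1 / 2) ^ (α + 2) * (moment α 0)⁻¹ ≤ (1 - ‖z‖) ^ (α + 2) * ‖k‖ ^ 2 := by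
    have h2 : 0 < 1 - ‖z‖ ^ 2 := by nlinarith
    have h3 : (1 / 2) ^ (α + 2) * (1 - ‖z‖ ^ 2) ^ (α + 2) ≤ (1 - ‖z‖) ^ (α + 2) := by
      rw [← Real.mul_rpow (by norm_num) h2.le]
      exact Real.rpow_le_rpow (by positivity) (by nlinarith) (by linarith)
    have h4 : 0 < (1 - ‖z‖ ^ 2) ^ (α + 2) := Real.rpow_pos_of_pos h2 _
    rw [hk, norm_kernel_sq hα hz, mul_inv, mul_comm (moment α 0)⁻¹, ← mul_assoc]
    refine mul_le_mul_of_nonneg_right ?_ (by positivity)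
    rw [← div_eq_mul_inv, le_div_iff₀ h4]
    exact h3
  calc δ / 2 * (c * ((1 / 2) ^ (α + 2) * (moment α 0)⁻¹)) * ‖k‖ ^ 2
      ≤ δ / 2 * (c * ((1 - ‖z‖) ^ (α + 2) * ‖k‖ ^ 2)) * ‖k‖ ^ 2 := by gcongr
    _ = δ / 2 * (c * (1 - ‖z‖) ^ (α + 2) * ‖analyticRep k z‖ ^ 2) := by rw [hkz]; ring
    _ ≤ δ / 2 * ∫ w in ball z (δ / 4 * (1 - ‖z‖)), ‖analyticRep k w‖ ^ 2 ∂weightedArea α := by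
        gcongr
        exact h z hz k
    _ = ∫ w in ball z (δ / 4 * (1 - ‖z‖)), δ / 2 * ‖analyticRep k w‖ ^ 2 ∂weightedArea α := by
        rw [integral_const_mul]
    _ ≤ ∫ w in ball z (δ / 4 * (1 - ‖z‖)), (1 - ‖φ w‖ ^ 2) * ‖analyticRep k w‖ ^ 2
          ∂weightedArea α := by
        refine setIntegral_mono_on ((integrable_norm_sq k).integrableOn.const_mul _)
          hI.integrableOn measurableSet_ball fun w hw => ?_
        exact mul_le_mul_of_nonneg_right (le_one_sub_norm_sq_of_mem_ball hφ hδ hδ1 hz hφz hw)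
          (sq_nonneg _)
    _ ≤ ∫ w, (1 - ‖φ w‖ ^ 2) * ‖analyticRep k w‖ ^ 2 ∂weightedArea α :=
        setIntegral_le_integral hI hnn

/-- Where `|φ(z)| ≤ 1 - δ` the kernel quotient is at least `c`, yet compactness makes it at most
`c/2` near the circle. -/
theorem exists_lt_norm_of_isCompactOperator (hα : -1 < α) {φ : ℂ → ℂ} (hφ : φ ∈ unitBallHInfty)
    (hE : IsCompactOperator (defectBar α φ hφ)) {δ : ℝ} (hδ : 0 < δ) :
    ∃ r < 1, ∀ z ∈ ball (0 : ℂ) 1, r < ‖z‖ → 1 - δ < ‖φ z‖ := by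
  obtain ⟨c, hc, h⟩ := exists_le_norm_inner_defectBar_kernel hα hφ
    (lt_min hδ one_pos) (min_le_right _ _)
  obtain ⟨r, hr, h'⟩ := exists_norm_inner_kernel_le_of_isCompactOperator hα hE (half_pos hc)
  refine ⟨r, hr, fun z hz hrz => ?_⟩
  by_contra hcon
  have h1 := h z hz ((not_lt.1 hcon).trans (by linarith [min_le_left δ 1]))
  have h2 := h' z hz hrz
  have h3 : 0 < ‖kernel α z‖ ^ 2 := by
    have := norm_kernel_pos hα hz
    positivity
  nlinarith

/-! ### Bounded analytic functions with boundary modulus one -/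

theorem norm_le_one_of_boundary {G : ℂ → ℂ} (hG : DifferentiableOn ℂ G (ball 0 1))
    (h : ∀ ε > 0, ∃ r < 1, ∀ z ∈ ball (0 : ℂ) 1, r < ‖z‖ → ‖G z‖ ≤ 1 + ε) {z : ℂ}
    (hz : z ∈ ball (0 : ℂ) 1) : ‖G z‖ ≤ 1 := by
  refine le_of_forall_pos_le_add fun ε hε => ?_
  obtain ⟨r, hr, hrz⟩ := h ε hε
  have hz1 : ‖z‖ < 1 := by simpa using hz
  obtain ⟨ρ, hρ, hρ1⟩ := exists_between (max_lt (max_lt hr hz1) one_pos)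
  have hρ0 : 0 < ρ := (le_max_right _ _).trans_lt hρ
  have hsub : closure (ball (0 : ℂ) ρ) ⊆ ball 0 1 := by
    rw [closure_ball _ hρ0.ne']
    exact closedBall_subset_ball hρ1
  refine Complex.norm_le_of_forall_mem_frontier_norm_le (U := ball 0 ρ) isBounded_ball
    (hG.mono hsub).diffContOnCl (fun w hw => ?_) (subset_closure ?_)
  · rw [frontier_ball _ hρ0.ne', mem_sphere_zero_iff_norm] at hw
    refine hrz w (by simpa [hw] using hρ1) ?_
    rw [hw]
    exact ((le_max_left _ _).trans (le_max_left _ _)).trans_lt hρ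
  · rw [mem_ball_zero_iff]
    exact ((le_max_right _ _).trans (le_max_left _ _)).trans_lt hρ

/-- The modulus of `φ` tends to one at the unit circle. -/
def UnimodularAtBoundary (φ : ℂ → ℂ) : Prop :=
  ∀ δ > 0, ∃ r < 1, ∀ z ∈ ball (0 : ℂ) 1, r < ‖z‖ → 1 - δ < ‖φ z‖

/-- The maximum principle for `1/φ` gives `|φ(0)| ≥ 1`, which is impossible unless `φ` is a
unimodular constant. -/
theorem exists_unimodular_eq_of_ne_zero {φ : ℂ → ℂ} (hφ : φ ∈ unitBallHInfty)
    (hb : UnimodularAtBoundary φ) (h0 : ∀ z ∈ ball (0 : ℂ) 1, φ z ≠ 0) :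
    ∃ c : ℂ, ‖c‖ = 1 ∧ ∀ z ∈ ball (0 : ℂ) 1, φ z = c := by
  by_contra hne
  have h1 := norm_lt_one_of_not_constant hφ hne (mem_ball_self one_pos)
  have h2 : ‖(φ 0)⁻¹‖ ≤ 1 := by
    refine norm_le_one_of_boundary (G := fun z => (φ z)⁻¹) (hφ.1.inv h0) (fun ε hε => ?_)
      (mem_ball_self one_pos)
    -- Chosen so that `1 - ε / (1 + ε) = (1 + ε)⁻¹`.
    obtain ⟨r, hr, h⟩ := hb (ε / (1 + ε)) (by positivity)
    refine ⟨r, hr, fun z hz hrz => ?_⟩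
    have h3 := h z hz hrz
    have h4 : 1 - ε / (1 + ε) = (1 + ε)⁻¹ := by
      field_simp
      ring
    rw [h4] at h3
    rw [norm_inv]
    exact (inv_lt_of_inv_lt₀ (by positivity) h3).le
  rw [norm_inv] at h2
  have h3 : 0 < ‖φ 0‖ := norm_pos_iff.2 (h0 0 (mem_ball_self one_pos))
  rw [inv_le_one₀ h3] at h2
  linarith

theorem unimodularAtBoundary_blaschkeFactor {a : ℂ} (ha : ‖a‖ < 1) :
    UnimodularAtBoundary (blaschkeFactor a) := by
  intro δ hδ
  have ha1 : 0 < 1 - ‖a‖ := by linarith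
  -- The radius comes from `1 - |b|² ≤ (1 - |z|²) / (1 - |a|)² ≤ 2 (1 - |z|) / (1 - |a|)²`, where
  -- `b` is the Blaschke factor at `z`.
  refine ⟨1 - δ / 2 * (1 - ‖a‖) ^ 2, by nlinarith [pow_pos ha1 2], fun z hz hrz => ?_⟩
  have hz1 : ‖z‖ < 1 := by simpa using hz
  have h := one_sub_norm_blaschkeFactor_sq ha hz1.le
  have hle := norm_blaschkeFactor_le ha hz1.le
  have hnn := norm_nonneg (blaschkeFactor a z)
  have hna := norm_nonneg a
  have hnz := norm_nonneg z
  have h1 : 1 - ‖a‖ ≤ ‖1 - conj a * z‖ := by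
    have := norm_sub_norm_le (1 : ℂ) (conj a * z)
    rw [norm_one, norm_mul, RCLike.norm_conj] at this
    nlinarith
  have h2 : (1 - ‖a‖ ^ 2) / ‖1 - conj a * z‖ ^ 2 ≤ 1 / (1 - ‖a‖) ^ 2 := by
    gcongr
    nlinarith
  have h3 : (1 - ‖z‖ ^ 2) * ((1 - ‖a‖ ^ 2) / ‖1 - conj a * z‖ ^ 2) ≤
      (1 - ‖z‖ ^ 2) * (1 / (1 - ‖a‖) ^ 2) := mul_le_mul_of_nonneg_left h2 (by nlinarith)
  have h4 : (1 - ‖z‖ ^ 2) * (1 / (1 - ‖a‖) ^ 2) < δ := by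
    rw [mul_one_div, div_lt_iff₀ (by positivity)]
    nlinarith
  nlinarith

/-- The quotient stays in the unit ball by the maximum principle, because the Blaschke factor has
modulus near one at the circle. It stays unimodular at the boundary because `|ψ| ≥ |φ|`. -/
theorem exists_eq_blaschkeFactor_mul {φ : ℂ → ℂ} (hφ : φ ∈ unitBallHInfty)
    (hb : UnimodularAtBoundary φ) {a : ℂ} (ha : ‖a‖ < 1) (h0 : φ a = 0) :
    ∃ ψ ∈ unitBallHInfty, UnimodularAtBoundary ψ ∧
      ∀ z ∈ ball (0 : ℂ) 1, φ z = blaschkeFactor a z * ψ z := by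
  have hamem : a ∈ ball (0 : ℂ) 1 := by simpa using ha
  set ψ : ℂ → ℂ := fun z => dslope φ a z * (1 - conj a * z) with hψ
  have hd : DifferentiableOn ℂ ψ (ball 0 1) :=
    ((Complex.differentiableOn_dslope (isOpen_ball.mem_nhds hamem)).2 hφ.1).mul (by fun_prop)
  have hfac : ∀ z ∈ ball (0 : ℂ) 1, φ z = blaschkeFactor a z * ψ z := by
    intro z hz
    have hne := one_sub_conj_mul_ne_zero ha (mem_ball_zero_iff.1 hz).le
    have h1 := sub_smul_dslope φ a z
    rw [h0, sub_zero, smul_eq_mul] at h1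
    change φ z = (z - a) / (1 - conj a * z) * (dslope φ a z * (1 - conj a * z))
    rw [← h1, div_mul_eq_mul_div, eq_div_iff hne]
    ring
  have hle : ∀ z ∈ ball (0 : ℂ) 1, ‖φ z‖ ≤ ‖ψ z‖ := fun z hz => by
    rw [hfac z hz, norm_mul]
    exact mul_le_of_le_one_left (norm_nonneg _)
      (norm_blaschkeFactor_le ha (mem_ball_zero_iff.1 hz).le)
  refine ⟨ψ, ⟨hd, fun z hz => norm_le_one_of_boundary hd (fun ε hε => ?_) hz⟩, fun δ hδ => ?_, hfac⟩
  · obtain ⟨r, hr, h⟩ := unimodularAtBoundary_blaschkeFactor ha (ε / (1 + ε)) (by positivity)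
    refine ⟨r, hr, fun z hz hrz => ?_⟩
    have h3 := h z hz hrz
    have h4 : 1 - ε / (1 + ε) = (1 + ε)⁻¹ := by
      field_simp
      ring
    rw [h4] at h3
    have h5 := hφ.2 z hz
    rw [hfac z hz, norm_mul] at h5
    have h6 : (1 + ε)⁻¹ * ‖ψ z‖ ≤ 1 :=
      (mul_le_mul_of_nonneg_right h3.le (norm_nonneg _)).trans h5
    rwa [inv_mul_le_iff₀ (by positivity), mul_one] at h6
  · obtain ⟨r, hr, h⟩ := hb δ hδ
    exact ⟨r, hr, fun z hz hrz => (h z hz hrz).trans_le (hle z hz)⟩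

theorem IsFiniteBlaschkeProduct.blaschkeFactor_mul {φ ψ : ℂ → ℂ} (hψ : IsFiniteBlaschkeProduct ψ)
    {a : ℂ} (ha : ‖a‖ < 1) (h : ∀ z ∈ ball (0 : ℂ) 1, φ z = blaschkeFactor a z * ψ z) :
    IsFiniteBlaschkeProduct φ := by
  obtain ⟨n, b, c, hc, hb, hz⟩ := hψ
  refine ⟨n + 1, Fin.cons a b, c, hc, fun i => ?_, fun z hz' => ?_⟩
  · refine Fin.cases ?_ (fun i => ?_) i
    · simpa using ha
    · simpa using hb i
  · rw [h z hz', hz z hz', Fin.prod_univ_succ]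
    simp only [Fin.cons_zero, Fin.cons_succ, blaschkeFactor]
    ring

/-- Each zero in a fixed smaller disk forces a definite decrease of `‖φ z₀‖`, which bounds the
number of zeros. -/
theorem isFiniteBlaschkeProduct_of_pow_lt {s : ℝ} (hs : 0 ≤ s) (hs1 : s < 1) {z₀ : ℂ}
    (hz₀ : z₀ ∈ ball (0 : ℂ) 1) (N : ℕ) (φ : ℂ → ℂ) (hφ : φ ∈ unitBallHInfty)
    (hb : UnimodularAtBoundary φ) (hzero : ∀ a ∈ ball (0 : ℂ) 1, φ a = 0 → ‖a‖ ≤ s)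
    (hN : (1 - (1 - ‖z₀‖ ^ 2) * ((1 - s ^ 2) / 4)) ^ N < ‖φ z₀‖ ^ 2) :
    IsFiniteBlaschkeProduct φ := by
  have hz1 : ‖z₀‖ < 1 := by simpa using hz₀
  have hzpos : 0 < 1 - ‖z₀‖ ^ 2 := by nlinarith [norm_nonneg z₀]
  have hspos : 0 < 1 - s ^ 2 := by nlinarith
  -- `Q` bounds `|b(z₀)|²` for every Blaschke factor `b` with zero in `|a| ≤ s`, so dividing by `b`
  -- turns the bound for `N + 1` into the bound for `N`. At `N = 0` the bound contradicts `|φ(z₀)| ≤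
  -- 1`.
  set Q := 1 - (1 - ‖z₀‖ ^ 2) * ((1 - s ^ 2) / 4) with hQ
  induction N generalizing φ with
  | zero =>
    have := hφ.2 z₀ hz₀
    rw [pow_zero] at hN
    nlinarith [norm_nonneg (φ z₀)]
  | succ N ih =>
    by_cases h0 : ∀ z ∈ ball (0 : ℂ) 1, φ z ≠ 0
    · obtain ⟨c, hc, h⟩ := exists_unimodular_eq_of_ne_zero hφ hb h0
      exact ⟨0, Fin.elim0, c, hc, fun i => i.elim0, fun z hz => by simpa using h z hz⟩
    · push Not at h0
      obtain ⟨a, ha, hφa⟩ := h0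
      have ha1 : ‖a‖ < 1 := by simpa using ha
      have has := hzero a ha hφa
      obtain ⟨ψ, hψ, hψb, hfac⟩ := exists_eq_blaschkeFactor_mul hφ hb ha1 hφa
      refine (ih ψ hψ hψb (fun b hb' hψ0 => hzero b hb' (by rw [hfac b hb', hψ0, mul_zero]))
        ?_).blaschkeFactor_mul ha1 hfac
      have h1 := one_sub_norm_blaschkeFactor_sq ha1 hz1.le
      have h2 : (1 - s ^ 2) / 4 ≤ (1 - ‖a‖ ^ 2) / ‖1 - conj a * z₀‖ ^ 2 := by
        have h3 : ‖1 - conj a * z₀‖ ≤ 2 := by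
          refine (norm_sub_le _ _).trans ?_
          rw [norm_one, norm_mul, RCLike.norm_conj]
          nlinarith [norm_nonneg a, norm_nonneg z₀]
        have h4 : 0 < ‖1 - conj a * z₀‖ :=
          norm_pos_iff.2 (one_sub_conj_mul_ne_zero ha1 hz1.le)
        refine div_le_div₀ ?_ ?_ (by positivity) ?_
        · nlinarith [norm_nonneg a]
        · nlinarith [norm_nonneg a]
        · nlinarith
      have h5 : ‖blaschkeFactor a z₀‖ ^ 2 ≤ Q := by
        have := mul_le_mul_of_nonneg_left h2 hzpos.le
        linarith
      have hQ0 : 0 < Q := by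
        have : (1 - ‖z₀‖ ^ 2) * ((1 - s ^ 2) / 4) ≤ 1 * (1 / 4) := by
          gcongr
          · nlinarith [norm_nonneg z₀]
          · nlinarith
        linarith
      rw [hfac z₀ hz₀, norm_mul, mul_pow, pow_succ'] at hN
      have h6 := mul_le_mul_of_nonneg_right h5 (sq_nonneg ‖ψ z₀‖)
      exact lt_of_mul_lt_mul_left (hN.trans_le h6) hQ0.le

theorem isFiniteBlaschkeProduct_of_unimodularAtBoundary {φ : ℂ → ℂ} (hφ : φ ∈ unitBallHInfty)
    (hb : UnimodularAtBoundary φ) : IsFiniteBlaschkeProduct φ := by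
  -- With `δ = 1` the boundary condition just says that `φ` has no zeros beyond radius `r`. Since
  -- `r` may be negative, `s = max r 0` is used, and any `t` strictly between `s` and 1 can serve as
  -- base point.
  obtain ⟨r, hr, h⟩ := hb 1 one_pos
  have hpos : ∀ z ∈ ball (0 : ℂ) 1, r < ‖z‖ → 0 < ‖φ z‖ := fun z hz hrz => by
    simpa using h z hz hrz
  set s := max r 0 with hs
  have hs0 : 0 ≤ s := le_max_right _ _
  have hs1 : s < 1 := max_lt hr one_pos
  obtain ⟨t, hst, ht1⟩ := exists_between hs1
  have ht0 : 0 < t := hs0.trans_lt hst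
  have hz₀ : (t : ℂ) ∈ ball (0 : ℂ) 1 := by simpa [abs_of_pos ht0] using ht1
  have hφz : 0 < ‖φ t‖ := hpos _ hz₀ (by
    rw [Complex.norm_real, Real.norm_of_nonneg ht0.le]
    exact (le_max_left _ _).trans_lt hst)
  have hzpos : 0 < 1 - ‖(t : ℂ)‖ ^ 2 := by
    rw [Complex.norm_real, Real.norm_of_nonneg ht0.le]
    nlinarith
  obtain ⟨N, hN⟩ := exists_pow_lt_of_lt_one (show 0 < ‖φ t‖ ^ 2 by positivity)
    (show 1 - (1 - ‖(t : ℂ)‖ ^ 2) * ((1 - s ^ 2) / 4) < 1 by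
      have : 0 < 1 - s ^ 2 := by nlinarith
      have : 0 < (1 - ‖(t : ℂ)‖ ^ 2) * ((1 - s ^ 2) / 4) := by positivity
      linarith)
  refine isFiniteBlaschkeProduct_of_pow_lt hs0 hs1 hz₀ N φ hφ hb (fun a ha h0 => ?_) hN
  by_contra hcon
  have := hpos a ha ((le_max_left _ _).trans_lt (not_le.1 hcon))
  rw [h0, norm_zero] at this
  exact lt_irrefl _ this

end WeightedBergman

end

/-! ### The equivalence of the four conditions. -/

theorem theorem18 (α : ℝ) (hα : -1 < α) (φ : ℂ → ℂ) (hφ : φ ∈ WeightedBergman.unitBallHInfty)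
    (hne : ¬ ∃ c : ℂ, ‖c‖ = 1 ∧ ∀ z ∈ Metric.ball (0 : ℂ) 1, φ z = c) :
    List.TFAE
      [IsCompactOperator (WeightedBergman.defectBar α φ hφ),
        WeightedBergman.IsFiniteBlaschkeProduct φ,
        WeightedBergman.rangeFunctions (WeightedBergman.defectBar α φ hφ)
          = WeightedBergman.genBergman (α - 2),
        WeightedBergman.rangeFunctions (WeightedBergman.defectBar α φ hφ)
          ⊆ WeightedBergman.genBergman (α - 2)] := by
  tfae_have 1 → 2 := fun h =>
    WeightedBergman.isFiniteBlaschkeProduct_of_unimodularAtBoundary hφ fun _ hδ =>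
      WeightedBergman.exists_lt_norm_of_isCompactOperator hα hφ h hδ
  tfae_have 2 → 3 :=
    WeightedBergman.rangeFunctions_defectBar_of_isFiniteBlaschkeProduct hα hφ hne
  tfae_have 3 → 4 := fun h => h.subset
  tfae_have 4 → 1 := WeightedBergman.isCompactOperator_of_rangeFunctions_subset hα
  tfae_finish
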